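/- Let $1\to F\to G\xrightarrow{f}\mathbb{Z}\to 1$ be a short exact sequence of groups in which $F=\ker f$ is free of finite rank $n\ge 2$ (so $G$ is a (non-abelian finitely generated free)-by-$\mathbb{Z}$ group). Conventions. A left-order on a group $H$ is a strict total order $\prec$ such that $a\prec b\iff ca\prec cb$; its positive cone is $P_\prec=\{h : 1\prec h\}$. It is called regular (respectively one-counter) if there are a finite set $X$, a surjective monoid homomorphism $\pi:X^*\to H$ and a regular (respectively one-counter) language $\mathcal{L}\subseteq X^*$ with $\pi(\mathcal{L})=P_\prec$; a one-counter language is one accepted, by accepting states, by a non-deterministic pushdown automaton whose stack alphabet has exactly one letter (and which can detect that its stack is empty). A left-order on $G$ is lexicographic led by $\mathbb{Z}$ if its positive cone is $f^{-1}(P_{\mathbb{Z}})\cup P_F$, where $P_{\mathbb{Z}}$ and $P_F$ are the positive cones of left-orders on $\mathbb{Z}$ and on $F$. A subset of a finitely generated group is coarsely connected if, in the Cayley graph with respect to every finite generating set, some $R$-neighbourhood of it ($R>0$) is connected. Then: 1. No lexicographic left-order on $G$ led by $\mathbb{Z}$ is regular. 2. There is a lexicographic left-order $\prec$ on $G$ led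 by $\mathbb{Z}$ that is one-counter, whose positive cone is coarsely connected, and that extends to a regular left-order on $G\times\mathbb{Z}$; that is, there is a regular left-order $\prec'$ on $G\times\mathbb{Z}$ with $(a,0)\prec'(b,0)\iff a\prec b$ for all $a,b\in G$. -/

import Mathlib

universe u v

/-! ### Left-orders and lexicographic left-orders -/

/-- A left-order on a group: a strict total order invariant under left multiplication. -/
structure IsLeftOrder {G : Type u} [Group G] (lt : G → G → Prop) : Prop where
  irrefl : ∀ a, ¬ lt a a
  trans : ∀ a b c, lt a b → lt b c → lt a c
  total : ∀ a b, lt a b ∨ a = b ∨ lt b a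
  mul_left : ∀ a b c, lt a b ↔ lt (c * a) (c * b)

/-- The positive cone `{g | 1 < g}` of an order on a group. -/
def positiveCone {G : Type u} [Group G] (lt : G → G → Prop) : Set G :=
  {g | lt 1 g}

/-- For an epimorphism `f : G → Q` with kernel `N`, the left-order `lt` on `G` is lexicographic
led by the quotient `Q` if there are left-orders on `N` and `Q`, with positive cones `P_N` and
`P_Q`, such that the positive cone of `lt` is `f⁻¹(P_Q) ∪ P_N`. -/
def IsLexLedByQuotient {G : Type u} {Q : Type v} [Group G] [Group Q] (f : G →* Q)
    (lt : G → G → Prop) : Prop :=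
  IsLeftOrder lt ∧
    ∃ ltN : f.ker → f.ker → Prop, ∃ ltQ : Q → Q → Prop,
      IsLeftOrder ltN ∧ IsLeftOrder ltQ ∧
        positiveCone lt = f ⁻¹' positiveCone ltQ ∪ Subtype.val '' positiveCone ltN

/-- The order `lt'` on `G × H` extends the order `lt` on `G`, where `G` is identified with
`G × {1}`. -/
def ExtendsLeftFactor {G : Type u} {H : Type v} [Group G] [Group H]
    (lt' : G × H → G × H → Prop) (lt : G → G → Prop) : Prop :=
  ∀ a b : G, lt' (a, 1) (b, 1) ↔ lt a b

/-! ### Pushdown automata and one-counter languages -/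

/-- A (non-deterministic) pushdown automaton with input alphabet `X`, stack alphabet `Γ` and
states `S`. `trans s a c` lists the possible moves from the state `s` when the input read is `a`
(`none` means that no input letter is read) and the top of the stack is `c` (`none` means that the
stack is empty). Stack words are written with the top of the stack as the head of the list. -/
structure PushdownAutomaton (X : Type u) (Γ S : Type) where
  trans : S → Option X → Option Γ → Set (S × List Γ)
  finite_trans : ∀ s a c, (trans s a c).Finite
  start : S
  initStack : List Γ
  accept : Set S

namespace PushdownAutomaton

/-- One move between configurations (state, remaining input, stack): the automaton reads the input
letter `a` or nothing, removes the top letter of the stack (if there is one), and puts the word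
`v` on top of what remains. -/
def Step {X : Type u} {Γ S : Type} (M : PushdownAutomaton X Γ S)
    (c d : S × List X × List Γ) : Prop :=
  ∃ (a : Option X) (v : List Γ), c.2.1 = a.toList ++ d.2.1 ∧
    (d.1, v) ∈ M.trans c.1 a c.2.2.head? ∧ d.2.2 = v ++ c.2.2.tail

/-- The language accepted by a pushdown automaton, by accepting states and with any final stack. -/
def accepts {X : Type u} {Γ S : Type} (M : PushdownAutomaton X Γ S) : Language X :=
  {w | ∃ s ∈ M.accept, ∃ γ : List Γ,
    Relation.ReflTransGen M.Step (M.start, w, M.initStack) (s, [], γ)}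

end PushdownAutomaton

/-- A language is one-counter if it is accepted by a pushdown automaton with finitely many states
whose stack alphabet has exactly one letter. -/
def Language.IsOneCounter {X : Type u} (L : Language X) : Prop :=
  ∃ (Γ S : Type), Nat.card Γ = 1 ∧ Finite S ∧
    ∃ M : PushdownAutomaton X Γ S, M.accepts = L

/-! ### Subsets of groups represented by languages -/

/-- The evaluation of a word over the alphabet `X` in a group, given the values of the letters. -/
def evalWord {X : Type u} {G : Type v} [Group G] (x : X → G) (w : List X) : G :=
  (w.map x).prod

/-- `S` is the image, under evaluation, of a language of the class `C` over some finite alphabet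
`X` whose evaluation map `X* → G` is onto (a finite monoid generating set of `G`). -/
def IsRepresentedBy {G : Type u} [Group G] (C : ∀ {X : Type}, Language X → Prop)
    (S : Set G) : Prop :=
  ∃ (X : Type) (_ : Finite X) (x : X → G), Function.Surjective (evalWord x) ∧
    ∃ L : Language X, C L ∧ evalWord x '' L = S

/-- A left-order is regular if its positive cone is represented by a regular language. -/
def IsRegularLeftOrder {G : Type u} [Group G] (lt : G → G → Prop) : Prop :=
  IsLeftOrder lt ∧ IsRepresentedBy Language.IsRegular (positiveCone lt)

/-- A left-order is one-counter if its positive cone is represented by a one-counter language. -/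
def IsOneCounterLeftOrder {G : Type u} [Group G] (lt : G → G → Prop) : Prop :=
  IsLeftOrder lt ∧ IsRepresentedBy Language.IsOneCounter (positiveCone lt)

/-! ### Coarse connectedness -/

/-- A set `Y` of vertices of a graph is coarsely connected if, for some `R > 0`, the vertices at
distance at most `R` from `Y` span a connected subgraph. -/
def SimpleGraph.IsCoarselyConnected {V : Type u} (Γ : SimpleGraph V) (Y : Set V) : Prop :=
  ∃ R : ℕ, 0 < R ∧ (Γ.induce {v | ∃ y ∈ Y, Γ.edist v y ≤ R}).Connected

/-- A subset of a group is coarsely connected if it is so in the Cayley graph of the group with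
respect to every finite generating set. -/
def IsCoarselyConnectedSubset {G : Type u} [Group G] (P : Set G) : Prop :=
  ∀ S : Set G, S.Finite → Subgroup.closure S = ⊤ → (SimpleGraph.mulCayley S).IsCoarselyConnected P

/-!
A regular positive cone is a rational subset of `G`. If the cone is lexicographic, the kernel `N` of
`G → Q` meets it in a face: a product of two positive elements has trivial image in `Q` only if
both factors do. Exchanging the tails of accepted paths then shows that, along the paths accepting
elements of `N`, the image in `Q` of the prefix read depends only on the state reached, so
that the same automaton, with relabelled edges, recognizes a positive cone of `N`. But a rational
subset is coarsely connected, and no positive cone `P` of a nonabelian free group is: a translate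
`k P` avoids a large ball and has elements in different branches of the tree.

For the existence part, let `w(g)` be the number of positive minus the number of negative letters
and turns in the reduced word of an element `g` of a free group, with signs given by a coding of the
letters by nonzero integers such that inverse letters have opposite codes. This `w` is odd off
`g = 1` and a quasimorphism of defect one. Hence `{(g, m) | 0 < w(g) + 2 m}` is a positive cone of
`N × ℤ`, and it is rational because an automaton can update `w` while reading a reduced word. The
lexicographic cone built on it gives a regular order on `G × ℤ`, whose restriction to `G` is
one-counter, with the counter tracking the `ℤ`-coordinate. This restriction is coarsely connected
because right translation by an element with positive image in `Q` moves its positive cone into the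
preimage of the positive cone of `Q`, which is rational.
-/

/-! ### Positive cones -/

/-- The intrinsic characterization of the positive cones of left-orders: a subsemigroup `P` such
that the group is the disjoint union of `P`, `P⁻¹` and `{1}`. -/
structure IsPositiveCone {G : Type*} [Group G] (P : Set G) : Prop where
  one_notMem : 1 ∉ P
  mul_mem : ∀ {a b}, a ∈ P → b ∈ P → a * b ∈ P
  mem_or_eq_one_or_inv_mem : ∀ a, a ∈ P ∨ a = 1 ∨ a⁻¹ ∈ P

/-- The left-invariant relation on a group whose positive cone is `P`. -/
def coneLT {G : Type*} [Group G] (P : Set G) (a b : G) : Prop :=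
  a⁻¹ * b ∈ P

@[simp]
theorem positiveCone_coneLT {G : Type*} [Group G] (P : Set G) : positiveCone (coneLT P) = P := by
  ext g
  simp [positiveCone, coneLT]

theorem IsLeftOrder.lt_iff_inv_mul_mem {G : Type*} [Group G] {lt : G → G → Prop}
    (h : IsLeftOrder lt) {a b : G} : lt a b ↔ a⁻¹ * b ∈ positiveCone lt := by
  rw [h.mul_left a b a⁻¹, inv_mul_cancel]
  rfl

theorem IsLeftOrder.isPositiveCone {G : Type*} [Group G] {lt : G → G → Prop}
    (h : IsLeftOrder lt) : IsPositiveCone (positiveCone lt) where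
  one_notMem := h.irrefl 1
  mul_mem {a b} ha hb := h.trans _ _ _ ha (h.lt_iff_inv_mul_mem.2 (by rwa [inv_mul_cancel_left]))
  mem_or_eq_one_or_inv_mem a := by
    rcases h.total 1 a with ha | rfl | ha
    · exact .inl ha
    · exact .inr (.inl rfl)
    · exact .inr (.inr (by simpa using h.lt_iff_inv_mul_mem.1 ha))

namespace IsPositiveCone

variable {G H : Type*} [Group G] [Group H] {P : Set G}

theorem isLeftOrder (hP : IsPositiveCone P) : IsLeftOrder (coneLT P) where
  irrefl a := by simpa [coneLT] using hP.one_notMem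
  trans a b c hab hbc := by simpa [coneLT, mul_assoc] using hP.mul_mem hab hbc
  total a b := by simpa [coneLT, inv_mul_eq_one] using hP.mem_or_eq_one_or_inv_mem (a⁻¹ * b)
  mul_left a b c := by simp [coneLT, mul_assoc]

theorem preimage (hP : IsPositiveCone P) {φ : H →* G} (hφ : Function.Injective φ) :
    IsPositiveCone (φ ⁻¹' P) where
  one_notMem := by simpa using hP.one_notMem
  mul_mem ha hb := by simpa using hP.mul_mem ha hb
  mem_or_eq_one_or_inv_mem a := by
    simpa [map_eq_one_iff φ hφ] using hP.mem_or_eq_one_or_inv_mem (φ a)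

theorem nonempty [Nontrivial G] (hP : IsPositiveCone P) : P.Nonempty := by
  obtain ⟨a, ha⟩ := exists_ne (1 : G)
  rcases hP.mem_or_eq_one_or_inv_mem a with h | h | h
  exacts [⟨a, h⟩, absurd h ha, ⟨a⁻¹, h⟩]

theorem closure_eq_top (hP : IsPositiveCone P) : Subgroup.closure P = ⊤ := by
  refine (Subgroup.eq_top_iff' _).2 fun a => ?_
  rcases hP.mem_or_eq_one_or_inv_mem a with h | rfl | h
  · exact Subgroup.subset_closure h
  · exact one_mem _
  · exact inv_mem_iff.1 (Subgroup.subset_closure h)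

end IsPositiveCone

/-- The lexicographic cone of an extension `N → G → Q`, led by the quotient: the elements with
image in `PQ`, and the elements of `N` lying in `PN`. -/
def lexCone {N G Q : Type*} [Group N] [Group G] [Group Q] (ι : N →* G) (f : G →* Q) (PN : Set N)
    (PQ : Set Q) : Set G :=
  f ⁻¹' PQ ∪ ι '' PN

theorem IsPositiveCone.lexCone {N G Q : Type*} [Group N] [Group G] [Group Q] {ι : N →* G}
    {f : G →* Q} (hι : Function.Injective ι) (hιf : ι.range = f.ker) {PN : Set N} {PQ : Set Q}
    (hN : IsPositiveCone PN) (hQ : IsPositiveCone PQ) : IsPositiveCone (lexCone ι f PN PQ) := by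
  have hfι (n : N) : f (ι n) = 1 := f.mem_ker.1 (hιf ▸ ⟨n, rfl⟩)
  refine ⟨?_, ?_, fun a => ?_⟩
  · rintro (h | ⟨n, hn, h⟩)
    · exact hQ.one_notMem (by simpa using h)
    · exact hN.one_notMem ((map_eq_one_iff ι hι).1 h ▸ hn)
  · rintro a b (ha | ⟨m, hm, rfl⟩) (hb | ⟨n, hn, rfl⟩)
    · exact .inl (by simpa using hQ.mul_mem ha hb)
    · exact .inl (by simpa [hfι] using ha)
    · exact .inl (by simpa [hfι] using hb)
    · exact .inr ⟨m * n, hN.mul_mem hm hn, map_mul ι m n⟩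
  · rcases hQ.mem_or_eq_one_or_inv_mem (f a) with h | h | h
    · exact .inl (.inl h)
    · obtain ⟨n, rfl⟩ : a ∈ ι.range := hιf ▸ h
      rcases hN.mem_or_eq_one_or_inv_mem n with hn | rfl | hn
      · exact .inl (.inr ⟨n, hn, rfl⟩)
      · exact .inr (.inl (map_one ι))
      · exact .inr (.inr (.inr ⟨n⁻¹, hn, map_inv ι n⟩))
    · exact .inr (.inr (.inl (by simpa using h)))

/-! ### Rational subsets of groups -/

/-- A finite-branching automaton over a group `G` with states `σ`: its edges carry elements of `G`,
so that a path spells the product of its labels. Such automata with finitely many states recognize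
the rational subsets of `G`, without reference to generators of `G`. -/
@[ext]
structure GroupAutomaton (G : Type u) (σ : Type) where
  edge : σ → G → σ → Prop
  finite_edge : ∀ p q, {a | edge p a q}.Finite
  start : Set σ
  accept : Set σ

namespace GroupAutomaton

variable {G : Type u} [Group G] {σ : Type} (A : GroupAutomaton G σ)

/-- `A.Path p g q`: some path of the automaton `A` from `p` to `q` spells `g`. -/
inductive Path (p : σ) : G → σ → Prop
  | refl : Path p 1 p
  | snoc {g a : G} {q r : σ} : Path p g q → A.edge q a r → Path p (g * a) r

/-- The subset of `G` recognized by a group automaton. -/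
def elements : Set G :=
  {g | ∃ p ∈ A.start, ∃ q ∈ A.accept, A.Path p g q}

variable {A}

theorem Path.trans {p q r : σ} {g h : G} (hg : A.Path p g q) (hh : A.Path q h r) :
    A.Path p (g * h) r := by
  induction hh with
  | refl => simpa using hg
  | snoc _ ha ih => simpa [mul_assoc] using ih.snoc ha

theorem Path.single {p q : σ} {a : G} (ha : A.edge p a q) : A.Path p a q := by
  simpa using Path.refl.snoc ha

theorem Path.cons {p q r : σ} {a h : G} (ha : A.edge p a q) (hh : A.Path q h r) :
    A.Path p (a * h) r :=
  (Path.single ha).trans hh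

theorem Path.map {H : Type v} [Group H] {τ : Type} {B : GroupAutomaton H τ} (φ : G →* H)
    (s : σ → τ) (hs : ∀ {p a q}, A.edge p a q → B.edge (s p) (φ a) (s q)) {p q : σ} {g : G}
    (hg : A.Path p g q) : B.Path (s p) (φ g) (s q) := by
  induction hg with
  | refl => simpa using Path.refl
  | snoc _ ha ih => simpa using ih.snoc (hs ha)

theorem Path.of_mem_closure_loops {q : σ} {T : Set G} (hT : ∀ t ∈ T, A.edge q t q) {k : G}
    (hk : k ∈ Submonoid.closure T) : A.Path q k q := by
  induction hk using Submonoid.closure_induction_right with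
  | one => exact .refl
  | mul_right _ _ t ht ih => exact ih.snoc (hT t ht)

theorem Path.mem_closure_labels {p q : σ} {g : G} (hg : A.Path p g q) :
    g ∈ Subgroup.closure {a | ∃ p q, A.edge p a q} := by
  induction hg with
  | refl => exact one_mem _
  | snoc _ ha ih => exact mul_mem ih (Subgroup.subset_closure ⟨_, _, ha⟩)

omit [Group G] in
theorem finite_labels [Finite σ] (A : GroupAutomaton G σ) : {a | ∃ p q, A.edge p a q}.Finite := by
  simpa only [Set.ofPred_exists] using
    Set.finite_iUnion fun p => Set.finite_iUnion fun q => A.finite_edge p q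

end GroupAutomaton

/-- A subset of a group is rational if a group automaton with finitely many states recognizes it.
For generating sets this means being represented by a regular language. -/
def IsRationalSubset {G : Type u} [Group G] (S : Set G) : Prop :=
  ∃ (σ : Type) (_ : Finite σ) (A : GroupAutomaton G σ), A.elements = S

theorem evalWord_append_singleton {X : Type u} {G : Type v} [Group G] (x : X → G) (w : List X)
    (a : X) : evalWord x (w ++ [a]) = evalWord x w * x a := by
  simp [evalWord]

section EvalNFA

variable {G : Type u} [Group G] {X σ : Type} [Finite X]

/-- The group automaton obtained from an NFA by evaluating the letters of its alphabet. -/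
def evalNFA (M : NFA X σ) (x : X → G) : GroupAutomaton G σ where
  edge p a q := ∃ i, x i = a ∧ q ∈ M.step p i
  finite_edge _ _ := (Set.finite_range x).subset fun _ ⟨i, hi, _⟩ => ⟨i, hi⟩
  start := M.start
  accept := M.accept

theorem evalNFA_path_iff {M : NFA X σ} {x : X → G} {p q : σ} {g : G} :
    (evalNFA M x).Path p g q ↔ ∃ w, evalWord x w = g ∧ q ∈ M.evalFrom {p} w := by
  constructor
  · intro h
    induction h with
    | refl => exact ⟨[], rfl, rfl⟩
    | snoc _ ha ih =>
      obtain ⟨w, rfl, hw⟩ := ih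
      obtain ⟨i, rfl, hi⟩ := ha
      refine ⟨w ++ [i], evalWord_append_singleton x w i, ?_⟩
      rw [NFA.evalFrom_append, NFA.evalFrom_singleton]
      exact NFA.mem_stepSet.2 ⟨_, hw, hi⟩
  · rintro ⟨w, rfl, hw⟩
    induction w using List.reverseRecOn generalizing q with
    | nil => exact Set.mem_singleton_iff.1 hw ▸ .refl
    | append_singleton w i ih =>
      rw [NFA.evalFrom_append, NFA.evalFrom_singleton] at hw
      obtain ⟨r, hr, hi⟩ := NFA.mem_stepSet.1 hw
      exact evalWord_append_singleton x w i ▸ (ih hr).snoc ⟨i, rfl, hi⟩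

theorem elements_evalNFA (M : NFA X σ) (x : X → G) :
    (evalNFA M x).elements = evalWord x '' M.accepts := by
  ext g
  constructor
  · rintro ⟨p, hp, q, hq, hg⟩
    obtain ⟨w, rfl, hw⟩ := evalNFA_path_iff.1 hg
    exact ⟨w, M.accepts_iff_exists_path.2
      ⟨p, hp, q, hq, (M.mem_evalFrom_iff_nonempty_path).1 hw⟩, rfl⟩
  · rintro ⟨w, hw, rfl⟩
    obtain ⟨p, hp, q, hq, h⟩ := M.accepts_iff_exists_path.1 hw
    exact ⟨p, hp, q, hq, evalNFA_path_iff.2 ⟨w, rfl, (M.mem_evalFrom_iff_nonempty_path).2 h⟩⟩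

theorem IsRepresentedBy.isRationalSubset {S : Set G}
    (hS : IsRepresentedBy Language.IsRegular S) : IsRationalSubset S := by
  obtain ⟨X, _, x, -, L, ⟨σ, _, M, rfl⟩, rfl⟩ := hS
  exact ⟨σ, inferInstance, evalNFA M.toNFA x, by rw [elements_evalNFA, M.toNFA_correct]⟩

end EvalNFA

theorem isRegular_accepts_nfa {X σ : Type*} [Finite σ] (M : NFA X σ) : M.accepts.IsRegular := by
  classical
  have := Fintype.ofFinite σ
  exact Language.isRegular_iff.2 ⟨Set σ, inferInstance, M.toDFA, M.toDFA_correct⟩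

/-- Inverses of the labels, on which the NFA blocks, have to be added to the alphabet for it to
generate the group. -/
theorem IsRationalSubset.isRepresentedBy {G : Type u} [Group G] {S : Set G}
    (hS : IsRationalSubset S) (hgen : Subgroup.closure S = ⊤) :
    IsRepresentedBy Language.IsRegular S := by
  obtain ⟨σ, _, A, rfl⟩ := hS
  obtain ⟨k, v, -, hv⟩ := A.finite_labels.fin_param
  let x (i : Fin k × Bool) : G := cond i.2 (v i.1) (v i.1)⁻¹
  have hx (w) : evalWord x w = FreeGroup.lift v (FreeGroup.mk w) := FreeGroup.lift_mk.symm
  let M : NFA (Fin k × Bool) σ :=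
    { step := fun p i => {q | i.2 = true ∧ A.edge p (v i.1) q}
      start := A.start
      accept := A.accept }
  have hM : evalNFA M x = A := by
    refine GroupAutomaton.ext ?_ rfl rfl
    ext p a q
    refine ⟨fun ⟨⟨i, b⟩, hi, hb, h⟩ => ?_, fun h => ?_⟩
    · obtain rfl : b = true := hb
      exact hi ▸ h
    · obtain ⟨i, rfl⟩ : a ∈ Set.range v := hv ▸ ⟨p, q, h⟩
      exact ⟨(i, true), rfl, rfl, h⟩
  refine ⟨Fin k × Bool, inferInstance, x, fun g => ?_, M.accepts, isRegular_accepts_nfa M, ?_⟩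
  · have hlabels : A.elements ⊆ Subgroup.closure (Set.range v) := by
      rintro _ ⟨p, -, q, -, hg⟩
      exact hv ▸ hg.mem_closure_labels
    have hg : g ∈ (FreeGroup.lift v).range := by
      rw [FreeGroup.range_lift_eq_closure]
      exact (Subgroup.closure_le _).2 hlabels (hgen ▸ Subgroup.mem_top g)
    obtain ⟨h, rfl⟩ := hg
    exact ⟨h.toWord, by rw [hx, FreeGroup.mk_toWord]⟩
  · rw [← elements_evalNFA, hM]

theorem IsPositiveCone.isRegularLeftOrder {G : Type u} [Group G] {P : Set G}
    (hP : IsPositiveCone P) (hrat : IsRationalSubset P) : IsRegularLeftOrder (coneLT P) :=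
  ⟨hP.isLeftOrder, by simpa using hrat.isRepresentedBy hP.closure_eq_top⟩

theorem IsRepresentedBy.groupFG {G : Type u} [Group G] {S : Set G}
    {C : ∀ {X : Type}, Language X → Prop} (hS : IsRepresentedBy C S) : Group.FG G := by
  obtain ⟨X, _, x, hx, -⟩ := hS
  refine Group.fg_iff.2 ⟨Set.range x, (Subgroup.eq_top_iff' _).2 fun g => ?_, Set.finite_range x⟩
  obtain ⟨w, rfl⟩ := hx g
  exact list_prod_mem fun a ha => by
    obtain ⟨i, -, rfl⟩ := List.mem_map.1 ha
    exact Subgroup.subset_closure ⟨i, rfl⟩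

namespace IsRationalSubset

variable {G : Type u} {H : Type v} [Group G] [Group H]

theorem image {S : Set G} (hS : IsRationalSubset S) (φ : G →* H) : IsRationalSubset (φ '' S) := by
  obtain ⟨σ, _, A, rfl⟩ := hS
  let B : GroupAutomaton H σ :=
    { edge := fun p b q => ∃ a, A.edge p a q ∧ φ a = b
      finite_edge := fun p q => (A.finite_edge p q).image φ
      start := A.start
      accept := A.accept }
  have lift {p q h} (hh : B.Path p h q) : ∃ g, A.Path p g q ∧ φ g = h := by
    induction hh with
    | refl => exact ⟨1, .refl, map_one φ⟩
    | snoc _ hb ih =>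
      obtain ⟨g, hg, rfl⟩ := ih
      obtain ⟨a, ha, rfl⟩ := hb
      exact ⟨g * a, hg.snoc ha, map_mul φ g a⟩
  refine ⟨σ, inferInstance, B, Set.ext fun h => ⟨?_, ?_⟩⟩
  · rintro ⟨p, hp, q, hq, hh⟩
    obtain ⟨g, hg, rfl⟩ := lift hh
    exact ⟨g, ⟨p, hp, q, hq, hg⟩, rfl⟩
  · rintro ⟨g, ⟨p, hp, q, hq, hg⟩, rfl⟩
    exact ⟨p, hp, q, hq, hg.map (B := B) φ id fun ha => ⟨_, ha, rfl⟩⟩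

theorem union {S T : Set G} (hS : IsRationalSubset S) (hT : IsRationalSubset T) :
    IsRationalSubset (S ∪ T) := by
  obtain ⟨σ, _, A, rfl⟩ := hS
  obtain ⟨τ, _, B, rfl⟩ := hT
  let C : GroupAutomaton G (σ ⊕ τ) :=
    { edge := fun p a q => Sum.LiftRel (A.edge · a ·) (B.edge · a ·) p q
      finite_edge := by
        rintro (p | p) (q | q)
        · simpa using A.finite_edge p q
        · simp
        · simp
        · simpa using B.finite_edge p q
      start := Sum.inl '' A.start ∪ Sum.inr '' B.start
      accept := Sum.inl '' A.accept ∪ Sum.inr '' B.accept }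
  have lift {p q g} (h : C.Path p g q) : Sum.LiftRel (A.Path · g ·) (B.Path · g ·) p q := by
    induction h with
    | refl => rcases p with p | p <;> constructor <;> exact .refl
    | snoc _ ha ih =>
      rcases ih with hp | hp <;> rcases ha with ha | ha <;> constructor <;> exact hp.snoc ha
  refine ⟨σ ⊕ τ, inferInstance, C, Set.ext fun g => ⟨?_, ?_⟩⟩
  · rintro ⟨_, ⟨p, hp, rfl⟩ | ⟨p, hp, rfl⟩, _, ⟨q, hq, rfl⟩ | ⟨q, hq, rfl⟩, hg⟩
    · exact .inl ⟨p, hp, q, hq, by simpa using lift hg⟩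
    · nomatch lift hg
    · nomatch lift hg
    · exact .inr ⟨p, hp, q, hq, by simpa using lift hg⟩
  · rintro (⟨p, hp, q, hq, hg⟩ | ⟨p, hp, q, hq, hg⟩)
    · exact ⟨.inl p, .inl ⟨p, hp, rfl⟩, .inl q, .inl ⟨q, hq, rfl⟩,
        hg.map (B := C) (.id G) Sum.inl fun ha => by simpa [C] using ha⟩
    · exact ⟨.inr p, .inr ⟨p, hp, rfl⟩, .inr q, .inr ⟨q, hq, rfl⟩,
        hg.map (B := C) (.id G) Sum.inr fun ha => by simpa [C] using ha⟩

/-- The lifted automaton may also multiply by generators of the kernel at any time. -/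
theorem preimage {S : Set H} (hS : IsRationalSubset S) {f : G →* H}
    (hf : Function.Surjective f) (hker : f.ker.FG) : IsRationalSubset (f ⁻¹' S) := by
  obtain ⟨σ, _, A, rfl⟩ := hS
  obtain ⟨T, hT, hTfin⟩ := (Subgroup.fg_iff _).1 hker
  have hTker {t} (ht : t ∈ T ∪ T⁻¹) : f t = 1 := by
    rw [← f.mem_ker, ← hT]
    rcases ht with ht | ht
    · exact Subgroup.subset_closure ht
    · exact inv_mem_iff.1 (Subgroup.subset_closure ht)
  let s := Function.surjInv hf
  have hs (h) : f (s h) = h := Function.surjInv_eq hf h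
  let B : GroupAutomaton G σ :=
    { edge := fun p a q => (A.edge p (f a) q ∧ s (f a) = a) ∨ (p = q ∧ a ∈ T ∪ T⁻¹)
      finite_edge := fun p q =>
        (((A.finite_edge p q).image s).union (hTfin.union hTfin.inv)).subset fun a ha =>
          ha.imp (fun ha => ⟨f a, ha⟩) And.right
      start := A.start
      accept := A.accept }
  have map {p q g} (hg : B.Path p g q) : A.Path p (f g) q := by
    induction hg with
    | refl => simpa using GroupAutomaton.Path.refl
    | snoc _ ha ih =>
      rcases ha with ⟨ha, -⟩ | ⟨rfl, ha⟩
      · simpa using ih.snoc ha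
      · simpa [hTker ha] using ih
  have loop (q) {k} (hk : f k = 1) : B.Path q k q :=
    .of_mem_closure_loops (A := B) (T := T ∪ T⁻¹) (fun _ ht => Or.inr ⟨rfl, ht⟩) <| by
      rwa [← Subgroup.closure_toSubmonoid, Subgroup.mem_toSubmonoid, hT]
  have lift {p q h} (hh : A.Path p h q) : ∃ g, B.Path p g q ∧ f g = h := by
    induction hh with
    | refl => exact ⟨1, .refl, map_one f⟩
    | @snoc _ a _ _ _ ha ih =>
      obtain ⟨g, hg, rfl⟩ := ih
      exact ⟨g * s a, hg.snoc (.inl ⟨by rwa [hs], by rw [hs]⟩), by rw [map_mul, hs]⟩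
  refine ⟨σ, inferInstance, B, Set.ext fun g => ⟨?_, ?_⟩⟩
  · rintro ⟨p, hp, q, hq, hg⟩
    exact ⟨p, hp, q, hq, map hg⟩
  · rintro ⟨p, hp, q, hq, hg⟩
    obtain ⟨g', hg', hfg⟩ := lift hg
    have hloop : B.Path q (g'⁻¹ * g) q := loop q (by simp [hfg])
    exact ⟨p, hp, q, hq, by simpa using hg'.trans hloop⟩

end IsRationalSubset

namespace GroupAutomaton

variable {G : Type u} {H : Type v} [Group G] [Group H] {σ : Type}

/-- `A.LiveAt f g p`: some accepted path of `A` representing an element of `f.ker` passes through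
the state `p` after having spelled `g`. -/
def LiveAt (A : GroupAutomaton G σ) (f : G →* H) (g : G) (p : σ) : Prop :=
  ∃ s ∈ A.start, ∃ t ∈ A.accept, ∃ h, A.Path s g p ∧ A.Path p h t ∧ f (g * h) = 1

/-- Exchanging the tails of two accepted paths through `p` yields two accepted elements with
mutually inverse images under `f`. -/
theorem LiveAt.map_eq {A : GroupAutomaton G σ} {f : G →* H}
    (hA : ∀ a ∈ A.elements, ∀ b ∈ A.elements, f a * f b = 1 → f a = 1) {g g' : G} {p : σ}
    (hg : A.LiveAt f g p) (hg' : A.LiveAt f g' p) : f g = f g' := by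
  obtain ⟨s, hs, t, ht, h, hsp, hpt, hgh⟩ := hg
  obtain ⟨s', hs', t', ht', h', hsp', hpt', hgh'⟩ := hg'
  rw [map_mul, mul_eq_one_iff_inv_eq] at hgh hgh'
  have := hA (g * h') ⟨s, hs, t', ht', hsp.trans hpt'⟩ (g' * h) ⟨s', hs', t, ht, hsp'.trans hpt⟩
    (by simp [← hgh, ← hgh', mul_assoc])
  rwa [map_mul, ← hgh', mul_inv_eq_one] at this

/-- The restriction of an automaton to the kernel of `f`, given a transversal `γ` of the images of
the states in the quotient. -/
def restrictKer (A : GroupAutomaton G σ) (f : G →* H) (γ : σ → G) : GroupAutomaton f.ker σ where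
  edge p n q := A.edge p ((γ p)⁻¹ * n * γ q) q
  finite_edge p q := (A.finite_edge p q).preimage fun _ _ _ _ h => by simpa using h
  start := {p ∈ A.start | γ p = 1}
  accept := {p ∈ A.accept | γ p = 1}

theorem path_of_restrictKer_path {A : GroupAutomaton G σ} {f : G →* H} {γ : σ → G} {p q : σ}
    {n : f.ker} (h : (A.restrictKer f γ).Path p n q) : A.Path p ((γ p)⁻¹ * n * γ q) q := by
  induction h with
  | refl => simpa using Path.refl
  | snoc _ ha ih => simpa [mul_assoc] using ih.snoc ha

theorem restrictKer_path {A : GroupAutomaton G σ} {f : G →* H} {γ : σ → G}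
    (hγ : ∀ {g p}, A.LiveAt f g p → f g = f (γ p)) {s p t : σ} {g h : G} (hs : s ∈ A.start)
    (hs1 : γ s = 1) (ht : t ∈ A.accept) (hg : A.Path s g p) (hh : A.Path p h t)
    (hgh : f (g * h) = 1) :
    ∃ n : f.ker, n = g * (γ p)⁻¹ ∧ (A.restrictKer f γ).Path s n p := by
  induction hg generalizing h with
  | refl => exact ⟨1, by simp [hs1], .refl⟩
  | @snoc g a q r hg ha ih =>
    have hlive : f (g * a) = f (γ r) := hγ ⟨s, hs, t, ht, h, hg.snoc ha, hh, hgh⟩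
    rw [mul_assoc] at hgh
    obtain ⟨n, hn, hpath⟩ := ih (.cons ha hh) hgh
    have hlive' : f g = f (γ q) := hγ ⟨s, hs, t, ht, a * h, hg, .cons ha hh, hgh⟩
    have hb : γ q * a * (γ r)⁻¹ ∈ f.ker := by
      simp [f.mem_ker, ← hlive, ← hlive']
    refine ⟨n * ⟨_, hb⟩, by simp [hn, mul_assoc], hpath.snoc ?_⟩
    simpa [restrictKer, mul_assoc] using ha

end GroupAutomaton

open GroupAutomaton in
theorem IsRationalSubset.preimage_ker {G : Type u} {H : Type v} [Group G] [Group H] {S : Set G}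
    (hS : IsRationalSubset S) {f : G →* H}
    (hf : ∀ a ∈ S, ∀ b ∈ S, f a * f b = 1 → f a = 1) :
    IsRationalSubset ((↑) ⁻¹' S : Set f.ker) := by
  obtain ⟨σ, _, A, rfl⟩ := hS
  have transversal (p) : ∃ c, (∀ g, A.LiveAt f g p → f g = f c) ∧
      ∀ g, A.LiveAt f g p → f g = 1 → c = 1 := by
    by_cases h : ∃ g, A.LiveAt f g p ∧ f g ≠ 1
    · obtain ⟨c, hc, hc1⟩ := h
      exact ⟨c, fun g hg => hg.map_eq hf hc, fun g hg hg1 => absurd (hc.map_eq hf hg) (hg1 ▸ hc1)⟩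
    · push Not at h
      exact ⟨1, fun g hg => by rw [h g hg, map_one], fun _ _ _ => rfl⟩
  choose γ hγ hγ1 using transversal
  refine ⟨σ, inferInstance, A.restrictKer f γ, Set.ext fun n => ⟨?_, ?_⟩⟩
  · rintro ⟨s, ⟨hs, hs1⟩, t, ⟨ht, ht1⟩, h⟩
    exact ⟨s, hs, t, ht, by simpa [hs1, ht1] using path_of_restrictKer_path h⟩
  · rintro ⟨s, hs, t, ht, h⟩
    have hn : f n = 1 := n.2
    have hs1 : γ s = 1 := hγ1 s 1 ⟨s, hs, t, ht, n, .refl, h, by simpa using hn⟩ (map_one f)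
    have ht1 : γ t = 1 := hγ1 t n ⟨s, hs, t, ht, 1, h, .refl, by simpa using hn⟩ hn
    obtain ⟨m, hm, hpath⟩ := restrictKer_path (hγ _ _) hs hs1 ht h .refl (by simpa using hn)
    obtain rfl : m = n := Subtype.ext (by simpa [ht1] using hm)
    exact ⟨s, ⟨hs, hs1⟩, t, ⟨ht, ht1⟩, hpath⟩

/-! ### Coarsely connected subsets -/

/-- The closed `R`-neighbourhood of a set of vertices of a graph. -/
abbrev graphThickening {V : Type u} (Γ : SimpleGraph V) (Y : Set V) (R : ℕ) : Set V :=
  {v | ∃ y ∈ Y, Γ.edist v y ≤ R}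

theorem subset_graphThickening {V : Type u} (Γ : SimpleGraph V) (Y : Set V) (R : ℕ) :
    Y ⊆ graphThickening Γ Y R :=
  fun y hy => ⟨y, hy, by simp⟩

theorem reachable_induce_graphThickening {V : Type u} {Γ : SimpleGraph V} {Y : Set V} {R : ℕ}
    {v y : V} (hy : y ∈ Y) (h : Γ.edist v y ≤ R) :
    (Γ.induce (graphThickening Γ Y R)).Reachable ⟨v, y, hy, h⟩
      ⟨y, subset_graphThickening Γ Y R hy⟩ := by
  classical
  obtain ⟨w, hw⟩ := Γ.exists_walk_of_edist_ne_top (ne_top_of_le_ne_top (ENat.natCast_ne_top R) h)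
  have hw' (z) (hz : z ∈ w.support) : z ∈ graphThickening Γ Y R := ⟨y, hy, by
    calc Γ.edist z y ≤ (w.dropUntil z hz).length := SimpleGraph.edist_le _
      _ ≤ w.length := mod_cast w.length_dropUntil_le_length hz
      _ ≤ R := hw ▸ h⟩
  exact ⟨w.induce _ hw'⟩

/-- Right multiplication by a fixed element moves all points by a bounded amount, because the
Cayley graph is invariant under left multiplication. -/
theorem exists_edist_mulCayley_le {G : Type u} [Group G] {S : Set G}
    (hS : Subgroup.closure S = ⊤) (g : G) :
    ∃ k : ℕ, ∀ p, (SimpleGraph.mulCayley S).edist p (p * g) ≤ k := by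
  have hg : g ∈ Subgroup.closure S := hS ▸ Subgroup.mem_top g
  induction hg using Subgroup.closure_induction with
  | mem s hs =>
    refine ⟨1, fun p => ?_⟩
    by_cases h : p = p * s
    · simp [← h]
    · exact SimpleGraph.edist_le ((SimpleGraph.mulCayley_adj' S _ _).2 ⟨h, s, hs, .inl rfl⟩).toWalk
  | one => exact ⟨0, by simp⟩
  | mul a b _ _ iha ihb =>
    obtain ⟨k, hk⟩ := iha
    obtain ⟨l, hl⟩ := ihb
    refine ⟨k + l, fun p => ?_⟩
    rw [← mul_assoc, Nat.cast_add]
    exact SimpleGraph.edist_triangle.trans (add_le_add (hk p) (hl _))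
  | inv a _ ih =>
    obtain ⟨k, hk⟩ := ih
    exact ⟨k, fun p => by simpa [SimpleGraph.edist_comm] using hk (p * a⁻¹)⟩

theorem isCoarselyConnectedSubset_of_connected_induce {G : Type u} [Group G] {P T : Set G}
    (hT : T.Finite) (hP : ((SimpleGraph.mulCayley T).induce P).Connected) :
    IsCoarselyConnectedSubset P := by
  intro S _ hS
  choose k hk using exists_edist_mulCayley_le hS
  obtain ⟨R, hR⟩ := (hT.image k).bddAbove
  set Γ := SimpleGraph.mulCayley S
  have hsub := subset_graphThickening Γ P (R + 1)
  have adj {p q : P} (h : ((SimpleGraph.mulCayley T).induce P).Adj p q) :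
      (Γ.induce (graphThickening Γ P (R + 1))).Reachable ⟨p, hsub p.2⟩ ⟨q, hsub q.2⟩ := by
    obtain ⟨-, t, ht, hpq⟩ := (SimpleGraph.mulCayley_adj' T _ _).1 h
    have hle : (k t : ℕ∞) ≤ (R + 1 : ℕ) := mod_cast (hR ⟨t, ht, rfl⟩).trans R.le_succ
    rcases hpq with hpq | hpq
    · refine reachable_induce_graphThickening q.2 (le_trans ?_ hle)
      exact (congrArg (Γ.edist p) hpq).symm.trans_le (hk t p)
    · refine (reachable_induce_graphThickening p.2 (le_trans ?_ hle)).symm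
      exact (congrArg (Γ.edist q) hpq).trans_le (hk t q)
  have reach (p q : P) :
      (Γ.induce (graphThickening Γ P (R + 1))).Reachable ⟨p, hsub p.2⟩ ⟨q, hsub q.2⟩ := by
    obtain ⟨w⟩ := hP.preconnected p q
    induction w with
    | nil => rfl
    | cons h _ ih => exact (adj h).trans ih
  obtain ⟨b⟩ := hP.nonempty
  refine ⟨R + 1, R.succ_pos, (SimpleGraph.connected_iff_exists_forall_reachable _).2
    ⟨⟨b, hsub b.2⟩, ?_⟩⟩
  rintro ⟨v, y, hy, hv⟩
  exact (reach b ⟨y, hy⟩).trans (reachable_induce_graphThickening hy hv).symm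

theorem reachable_induce_mulCayley {G : Type u} [Group G] {P T : Set G} {p q : G} (hp : p ∈ P)
    (hq : q ∈ P) (h : p⁻¹ * q ∈ T) :
    ((SimpleGraph.mulCayley T).induce P).Reachable ⟨p, hp⟩ ⟨q, hq⟩ := by
  by_cases hpq : p = q
  · subst hpq
    rfl
  · exact SimpleGraph.Adj.reachable <| SimpleGraph.induce_adj.2 <|
      (SimpleGraph.mulCayley_adj' T _ _).2 ⟨hpq, _, h, .inl (mul_inv_cancel_left p q)⟩

theorem GroupAutomaton.exists_completion {G : Type u} [Group G] {σ : Type}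
    (A : GroupAutomaton G σ) : ∃ c : σ → G, (∀ t ∈ A.accept, c t = 1) ∧
      ∀ {p h t}, t ∈ A.accept → A.Path p h t → ∃ t' ∈ A.accept, A.Path p (c p) t' := by
  have completion (p) : ∃ c, (p ∈ A.accept → c = 1) ∧
      ∀ {h t}, t ∈ A.accept → A.Path p h t → ∃ t' ∈ A.accept, A.Path p c t' := by
    by_cases hp : p ∈ A.accept
    · exact ⟨1, fun _ => rfl, fun _ _ => ⟨p, hp, .refl⟩⟩
    by_cases hp' : ∃ t ∈ A.accept, ∃ h, A.Path p h t
    · obtain ⟨t, ht, h, hh⟩ := hp'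
      exact ⟨h, fun hp' => absurd hp' hp, fun _ _ => ⟨t, ht, hh⟩⟩
    · exact ⟨1, fun _ => rfl, fun ht hh => absurd ⟨_, ht, _, hh⟩ hp'⟩
  choose c hc1 hc using completion
  exact ⟨c, hc1, fun ht hh => hc _ ht hh⟩

/-- Completing the prefixes of an accepted path to accepted elements, in a way depending only on
the state reached, gives a walk with steps in a finite set. -/
theorem IsRationalSubset.exists_connected_induce {G : Type u} [Group G] {S : Set G}
    (hS : IsRationalSubset S) (hne : S.Nonempty) :
    ∃ T : Set G, T.Finite ∧ ((SimpleGraph.mulCayley T).induce S).Connected := by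
  obtain ⟨σ, _, A, rfl⟩ := hS
  obtain ⟨c, hc1, hc⟩ := A.exists_completion
  let T : Set G := ⋃ p, ⋃ q, (fun a => (c p)⁻¹ * a * c q) '' insert 1 {a | ∃ p q, A.edge p a q}
  have hT : T.Finite := Set.finite_iUnion fun p => Set.finite_iUnion fun q =>
    (A.finite_labels.insert 1).image _
  have mem_T {p q a} (ha : a = 1 ∨ ∃ p q, A.edge p a q) : (c p)⁻¹ * a * c q ∈ T :=
    Set.mem_iUnion₂.2 ⟨p, q, a, ha, rfl⟩
  have mem {s p t g h} (hs : s ∈ A.start) (ht : t ∈ A.accept) (hg : A.Path s g p)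
      (hh : A.Path p h t) : g * c p ∈ A.elements := by
    obtain ⟨t', ht', hh'⟩ := hc ht hh
    exact ⟨s, hs, t', ht', hg.trans hh'⟩
  have reach_completion {s p t g h} (hs : s ∈ A.start) (ht : t ∈ A.accept) (hg : A.Path s g p)
      (hh : A.Path p h t) : ∃ hcs hgc, ((SimpleGraph.mulCayley T).induce A.elements).Reachable
        ⟨c s, hcs⟩ ⟨g * c p, hgc⟩ := by
    induction hg generalizing h with
    | refl =>
      have := mem hs ht .refl hh
      exact ⟨by simpa using this, this, by simp⟩
    | snoc hg ha ih =>
      obtain ⟨hcs, hgc, hr⟩ := ih (.cons ha hh)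
      exact ⟨hcs, mem hs ht (hg.snoc ha) hh, hr.trans <| reachable_induce_mulCayley _ _ <| by
        simpa [mul_assoc] using mem_T (.inr ⟨_, _, ha⟩)⟩
  obtain ⟨_, s₀, hs₀, t₀, ht₀, h₀⟩ := hne
  have hcs₀ : c s₀ ∈ A.elements := by simpa using mem hs₀ ht₀ .refl h₀
  refine ⟨T, hT, (SimpleGraph.connected_iff_exists_forall_reachable _).2 ⟨⟨c s₀, hcs₀⟩, ?_⟩⟩
  rintro ⟨g, s, hs, t, ht, h⟩
  obtain ⟨hcs, hgc, hr⟩ := reach_completion hs ht h .refl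
  refine (reachable_induce_mulCayley hcs₀ hcs ?_).trans ?_
  · simpa using mem_T (.inl rfl)
  · simpa [hc1 t ht] using hr

/-- A right translation moving `P` into a connected part of `P` connects the whole of `P`. -/
theorem connected_induce_mulCayley_insert {G : Type u} [Group G] {S P T : Set G} {t : G}
    (hS : ((SimpleGraph.mulCayley T).induce S).Connected) (hSP : S ⊆ P)
    (ht : ∀ p ∈ P, p * t ∈ S) : ((SimpleGraph.mulCayley (insert t T)).induce P).Connected := by
  let φ : (SimpleGraph.mulCayley T).induce S →g (SimpleGraph.mulCayley (insert t T)).induce P :=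
    ⟨Set.inclusion hSP, fun {p q} h => by
      obtain ⟨hne, g, hg, h⟩ := (SimpleGraph.mulCayley_adj' T _ _).1 h
      exact (SimpleGraph.mulCayley_adj' _ _ _).2 ⟨hne, g, .inr hg, h⟩⟩
  obtain ⟨b, hb⟩ := hS.nonempty
  refine (SimpleGraph.connected_iff_exists_forall_reachable _).2 ⟨⟨b, hSP hb⟩, ?_⟩
  rintro ⟨p, hp⟩
  exact ((hS.preconnected ⟨b, hb⟩ ⟨p * t, ht p hp⟩).map φ).trans <|
    .symm <| reachable_induce_mulCayley hp _ <| by simp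

/-! ### Reduced words in free groups -/

section ReducedWords

open FreeGroup

variable {α : Type*}

theorem exists_isReduced_append {L₁ L₂ : List (α × Bool)} (h₁ : IsReduced L₁)
    (h₂ : IsReduced L₂) :
    ∃ u w v, L₁ = u ++ w ∧ L₂ = invRev w ++ v ∧ IsReduced (u ++ v) := by
  induction L₁ using List.reverseRecOn generalizing L₂ with
  | nil => exact ⟨[], [], L₂, by simp [h₂]⟩
  | append_singleton L x ih =>
    rcases L₂ with _ | ⟨y, L₂⟩
    · exact ⟨L ++ [x], [], [], by simp [h₁]⟩
    by_cases hxy : y = (x.1, !x.2)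
    · obtain ⟨u, w, v, rfl, rfl, h⟩ := ih (h₁.infix ⟨[], [x], by simp⟩)
        (h₂.infix ⟨[y], [], by simp⟩ : IsReduced L₂)
      exact ⟨u, w ++ [x], v, by simp [hxy, invRev, h]⟩
    · refine ⟨L ++ [x], [], y :: L₂, by simp, by simp, List.isChain_append.2 ⟨h₁, h₂, ?_⟩⟩
      have hcompat : x.1 = y.1 → x.2 = y.2 := fun h => by
        by_contra h'
        exact hxy (Prod.ext h.symm (Bool.eq_not_of_ne (Ne.symm h')))
      simpa using hcompat

variable [DecidableEq α]

theorem exists_toWord_mul_eq_append (g h : FreeGroup α) :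
    ∃ u w v, g.toWord = u ++ w ∧ h.toWord = invRev w ++ v ∧ (g * h).toWord = u ++ v := by
  obtain ⟨u, w, v, hg, hh, hred⟩ :=
    exists_isReduced_append (isReduced_toWord (x := g)) (isReduced_toWord (x := h))
  have hmul : g * h = mk (u ++ v) := by
    rw [← mk_toWord (x := g), ← mk_toWord (x := h), hg, hh, ← mul_mk, ← mul_mk, ← mul_mk, ← inv_mk]
    group
  exact ⟨u, w, v, hg, hh, by rw [hmul, toWord_mk, hred.reduce_eq]⟩

theorem head?_toWord_mul_of_norm_lt {g h : FreeGroup α} (hn : h.norm < g.norm) :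
    (g * h).toWord.head? = g.toWord.head? := by
  obtain ⟨u, w, v, hg, hh, hgh⟩ := exists_toWord_mul_eq_append g h
  have hu : u ≠ [] := by
    rintro rfl
    simp only [FreeGroup.norm, hg, hh, List.nil_append, List.length_append, invRev_length] at hn
    omega
  rw [hg, hgh, List.head?_append_of_ne_nil _ hu, List.head?_append_of_ne_nil _ hu]

theorem finite_setOf_norm_le [Finite α] (n : ℕ) : {g : FreeGroup α | g.norm ≤ n}.Finite :=
  (List.finite_length_le (α × Bool) n).preimage toWord_injective.injOn

theorem head?_toWord_of_mul {g : FreeGroup α} {i : α} (h : ∀ b, g.toWord.head? ≠ some (i, b)) :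
    (of i * g).toWord.head? = some (i, true) := by
  have hred : IsReduced ((i, true) :: g.toWord) := by
    refine List.isChain_cons.2 ⟨fun y hy hiy => absurd hy ?_, isReduced_toWord⟩
    rw [show y = (i, y.2) from Prod.ext hiy.symm rfl]
    exact h _
  rw [toWord_mul, toWord_of, List.singleton_append, hred.reduce_eq, List.head?_cons]

theorem norm_inv_mul_le_length {p q : FreeGroup α}
    (w : (SimpleGraph.mulCayley (Set.range (of : α → FreeGroup α))).Walk p q) :
    (p⁻¹ * q).norm ≤ w.length := by
  induction w with
  | nil => simp
  | @cons p r q h w ih =>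
    have hpr : (p⁻¹ * r).norm ≤ 1 := by
      obtain ⟨-, _, ⟨i, rfl⟩, rfl | rfl⟩ := (SimpleGraph.mulCayley_adj' _ _ _).1 h <;> simp
    calc (p⁻¹ * q).norm = (p⁻¹ * r * (r⁻¹ * q)).norm := by simp [mul_assoc]
      _ ≤ (p⁻¹ * r).norm + (r⁻¹ * q).norm := norm_mul_le _ _
      _ ≤ 1 + w.length := by gcongr
      _ = (w.cons h).length := by simp [add_comm]

theorem norm_inv_mul_le_of_edist_le {p q : FreeGroup α} {R : ℕ}
    (h : (SimpleGraph.mulCayley (Set.range (of : α → FreeGroup α))).edist p q ≤ R) :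
    (p⁻¹ * q).norm ≤ R := by
  obtain ⟨w, hw⟩ :=
    SimpleGraph.exists_walk_of_edist_ne_top (ne_top_of_le_ne_top (ENat.natCast_ne_top R) h)
  exact (norm_inv_mul_le_length w).trans (by exact_mod_cast hw ▸ h)

end ReducedWords

/-! ### Left-orders on free groups are not regular -/

namespace IsLeftOrder

theorem exists_forall_lt {G : Type*} [Group G] {lt : G → G → Prop} [Nontrivial G]
    (h : IsLeftOrder lt) {A : Set G} (hA : A.Finite) : ∃ g, ∀ a ∈ A, lt a g := by
  obtain ⟨p, hp⟩ := h.isPositiveCone.nonempty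
  have lt_mul (a) : lt a (a * p) := h.lt_iff_inv_mul_mem.2 (by simpa using hp)
  induction A, hA using Set.Finite.induction_on with
  | empty => exact ⟨1, by simp⟩
  | @insert a A _ _ ih =>
    obtain ⟨g, hg⟩ := ih
    rcases h.total a g with hag | rfl | hga
    · exact ⟨g, by simpa [hag] using hg⟩
    · exact ⟨a * p, by simpa [lt_mul] using fun b hb => h.trans _ _ _ (hg b hb) (lt_mul a)⟩
    · exact ⟨a * p, by
        simpa [lt_mul] using fun b hb => h.trans _ _ _ (h.trans _ _ _ (hg b hb) hga) (lt_mul a)⟩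

open FreeGroup

variable {α : Type*} [Nontrivial α] {lt : FreeGroup α → FreeGroup α → Prop}

theorem exists_lt_head?_ne [DecidableEq α] [Finite α] (h : IsLeftOrder lt) (k : FreeGroup α) :
    ∃ g g', lt k g ∧ lt k g' ∧ g.toWord.head? ≠ g'.toWord.head? := by
  obtain ⟨g, hg⟩ := h.exists_forall_lt
    ((Set.finite_range fun i => (of i)⁻¹ * k).insert k)
  obtain ⟨i, hi⟩ : ∃ i, ∀ b, g.toWord.head? ≠ some (i, b) := by
    rcases g.toWord.head? with _ | ⟨j, b⟩
    · exact ⟨Classical.arbitrary α, by simp⟩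
    · obtain ⟨i, hi⟩ := exists_ne j
      exact ⟨i, fun b => by simp [hi.symm]⟩
  refine ⟨g, of i * g, hg k (.inl rfl), ?_, fun heq => hi true (heq.trans (head?_toWord_of_mul hi))⟩
  simpa using (h.mul_left _ _ (of i)).1 (hg _ (.inr ⟨i, rfl⟩))

/-- Choose `k` above a large ball. Near the translate of the positive cone by `k` words are then
long, so that moving along an edge does not change their first letters; but there are elements
above `k` with different first letters. -/
theorem not_isCoarselyConnectedSubset [Finite α] (h : IsLeftOrder lt) :
    ¬ IsCoarselyConnectedSubset (positiveCone lt) := by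
  classical
  intro hconn
  obtain ⟨R, -, hR⟩ := hconn (Set.range of) (Set.finite_range of) (closure_range_of α)
  obtain ⟨k, hk⟩ := h.exists_forall_lt (finite_setOf_norm_le (α := α) (R + 1))
  have norm_gt {x y} (hy : lt 1 y) (hxy : (SimpleGraph.mulCayley (Set.range of)).edist x y ≤ R) :
      1 < (k * x).norm := by
    by_contra! hx
    have hky : (k * y).norm ≤ R + 1 := by
      calc (k * y).norm = (k * x * (x⁻¹ * y)).norm := by simp [mul_assoc]
        _ ≤ (k * x).norm + (x⁻¹ * y).norm := norm_mul_le _ _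
        _ ≤ R + 1 := by linarith [norm_inv_mul_le_of_edist_le hxy]
    exact h.irrefl k (h.trans _ _ _ (by simpa using (h.mul_left _ _ k).1 hy) (hk _ hky))
  have head_eq (x y : graphThickening (SimpleGraph.mulCayley (Set.range of)) (positiveCone lt) R) :
      (k * x.1).toWord.head? = (k * y.1).toWord.head? := by
    obtain ⟨w⟩ := hR.preconnected x y
    induction w with
    | nil => rfl
    | @cons x y _ hxy _ ih =>
      rw [← ih, eq_comm]
      have hnorm := norm_inv_mul_le_length (SimpleGraph.induce_adj.1 hxy).toWalk
      obtain ⟨p, hp, hxp⟩ := x.2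
      have hlt : ((x : FreeGroup α)⁻¹ * y).norm < (k * x).norm :=
        hnorm.trans_lt (by simpa using norm_gt hp hxp)
      have := head?_toWord_mul_of_norm_lt hlt
      rwa [mul_assoc, mul_inv_cancel_left] at this
  obtain ⟨g, g', hg, hg', hne⟩ := h.exists_lt_head?_ne k
  have hmem {g} (hg : lt k g) := subset_graphThickening
    (SimpleGraph.mulCayley (Set.range of)) _ R (h.lt_iff_inv_mul_mem.1 hg)
  exact hne (by simpa using head_eq ⟨_, hmem hg⟩ ⟨_, hmem hg'⟩)

end IsLeftOrder

theorem finite_of_fg_freeGroup {α : Type*} [Group.FG (FreeGroup α)] : Finite α := by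
  let φ : FreeGroup α →* Multiplicative (α →₀ ℤ) :=
    FreeGroup.lift fun i => .ofAdd (Finsupp.single i 1)
  have hφ : Function.Surjective φ := by
    refine MonoidHom.range_eq_top.1 ((Subgroup.eq_top_iff' _).2 fun x => ?_)
    induction x using Multiplicative.rec with | ofAdd x => ?_
    induction x using Finsupp.induction_linear with
    | zero => exact one_mem _
    | add x y hx hy => exact mul_mem hx hy
    | single i m => exact ⟨FreeGroup.of i ^ m, by simp [φ, ← ofAdd_zsmul]⟩
  have : Group.FG (Multiplicative (α →₀ ℤ)) := Group.fg_of_surjective hφ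
  have : Module.Finite ℤ (α →₀ ℤ) :=
    Module.Finite.iff_addGroup_fg.2 (AddGroup.fg_iff_mul_fg.2 inferInstance)
  exact Module.Finite.finite_basis (Finsupp.basisSingleOne (R := ℤ))

theorem IsPositiveCone.not_isRationalSubset {α : Type*} [Nontrivial α] {P : Set (FreeGroup α)}
    (hP : IsPositiveCone P) : ¬ IsRationalSubset P := by
  intro hrat
  have := (hrat.isRepresentedBy hP.closure_eq_top).groupFG
  have := finite_of_fg_freeGroup (α := α)
  obtain ⟨T, hT, hconn⟩ := hrat.exists_connected_induce hP.nonempty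
  exact hP.isLeftOrder.not_isCoarselyConnectedSubset (by
    simpa using isCoarselyConnectedSubset_of_connected_induce hT hconn)

/-- Both factors of a product of positive elements lying in the kernel lie in the kernel, so the
positive cone of the kernel would be rational as well. -/
theorem IsLexLedByQuotient.not_isRegularLeftOrder {G : Type u} {Q : Type v} [Group G] [Group Q]
    {f : G →* Q} {lt : G → G → Prop} (h : IsLexLedByQuotient f lt) {α : Type*} [Nontrivial α]
    (e : f.ker ≃* FreeGroup α) : ¬ IsRegularLeftOrder lt := by
  rintro ⟨hlt, hreg⟩
  obtain ⟨-, ltN, ltQ, -, hQ, hcone⟩ := h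
  have convex : ∀ a ∈ positiveCone lt, ∀ b ∈ positiveCone lt, f a * f b = 1 → f a = 1 := by
    have one_or_pos {a} (ha : a ∈ positiveCone lt) : f a = 1 ∨ f a ∈ positiveCone ltQ := by
      rw [hcone] at ha
      obtain ha | ⟨n, -, rfl⟩ := ha
      exacts [.inr ha, .inl n.2]
    intro a ha b hb hab
    rcases one_or_pos ha, one_or_pos hb with ⟨ha | ha, hb | hb⟩
    · exact ha
    · exact ha
    · simpa [hb] using hab
    · exact absurd (hab ▸ hQ.isPositiveCone.mul_mem ha hb) hQ.isPositiveCone.one_notMem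
  have hker : IsRationalSubset ((↑) ⁻¹' positiveCone lt : Set f.ker) :=
    hreg.isRationalSubset.preimage_ker convex
  have hrat := hker.image e.toMonoidHom
  refine IsPositiveCone.not_isRationalSubset (P := e '' _) ?_ hrat
  rw [show e '' ((↑) ⁻¹' positiveCone lt) = e.symm ⁻¹' _ from e.toEquiv.image_eq_preimage_symm _]
  exact (hlt.isPositiveCone.preimage f.ker.subtype_injective).preimage
    (φ := e.symm.toMonoidHom) e.symm.injective

/-! ### An odd quasimorphism on a free group -/

section Weight

open FreeGroup

variable {α : Type*} [Encodable α]

/-- A nonzero integer encoding of the letters of a free group, for which inverse letters have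
opposite codes: a word is reduced if and only if no two consecutive codes cancel. -/
def letterCode (x : α × Bool) : ℤ :=
  if x.2 then (Encodable.encode x.1 : ℤ) + 1 else -((Encodable.encode x.1 : ℤ) + 1)

theorem letterCode_ne_zero (x : α × Bool) : letterCode x ≠ 0 := by
  unfold letterCode; split <;> omega

theorem letterCode_inv (x : α × Bool) : letterCode (x.1, !x.2) = -letterCode x := by
  rcases x with ⟨i, _ | _⟩ <;> simp [letterCode]

theorem letterCode_add_ne_zero {x y : α × Bool} (h : x.1 = y.1 → x.2 = y.2) :
    letterCode x + letterCode y ≠ 0 := by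
  have hcode : Encodable.encode x.1 = Encodable.encode y.1 → x.2 = y.2 :=
    fun he => h (Encodable.encode_injective he)
  unfold letterCode
  rcases hx : x.2 <;> rcases hy : y.2 <;> simp only [hx, hy, if_true] at hcode ⊢ <;> grind

/-- The sum of the signs of the letters of a word and of the signs of its turns. -/
def wordWeight : List (α × Bool) → ℤ
  | [] => 0
  | [x] => (letterCode x).sign
  | x :: y :: l =>
    (letterCode x).sign + (letterCode x + letterCode y).sign + wordWeight (y :: l)

/-- The sign of the turn from the last letter `a` of a word to the first letter `b` of the next
one, which is zero if one of the two words is empty. The sign of the sum of the codes changes with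
the turn `x y` when it is inverted to `y⁻¹ x⁻¹`, and it is subadditive up to an error of one. -/
def turnSign (a b : Option (α × Bool)) : ℤ :=
  match a, b with
  | some x, some y => (letterCode x + letterCode y).sign
  | _, _ => 0

theorem wordWeight_cons (x : α × Bool) (l : List (α × Bool)) :
    wordWeight (x :: l) = (letterCode x).sign + turnSign (some x) l.head? + wordWeight l := by
  cases l <;> simp [wordWeight, turnSign]

theorem wordWeight_append (l₁ l₂ : List (α × Bool)) :
    wordWeight (l₁ ++ l₂) =
      wordWeight l₁ + turnSign l₁.getLast? l₂.head? + wordWeight l₂ := by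
  induction l₁ with
  | nil => simp [wordWeight, turnSign]
  | cons x l ih =>
    rcases l with _ | ⟨y, l⟩
    · simpa [wordWeight] using wordWeight_cons x l₂
    · rw [List.cons_append, wordWeight_cons, ih, wordWeight_cons x (y :: l)]
      simp only [List.cons_append, List.head?_cons, List.getLast?_cons_cons]
      ring

theorem getLast?_invRev {α : Type*} (l : List (α × Bool)) :
    (invRev l).getLast? = l.head?.map fun x => (x.1, !x.2) := by
  simp [invRev]

theorem wordWeight_invRev (l : List (α × Bool)) :
    wordWeight (invRev l) = -wordWeight l := by
  induction l with
  | nil => simp [wordWeight]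
  | cons x l ih =>
    have : invRev (x :: l) = invRev l ++ [(x.1, !x.2)] := by simp [invRev]
    rw [this, wordWeight_append, ih, wordWeight_cons x l, getLast?_invRev]
    cases l.head? with
    | none => simp [turnSign, wordWeight, letterCode_inv]
    | some y =>
      simp only [turnSign, wordWeight, letterCode_inv, Option.map_some, List.head?_cons,
        Int.sign_neg, ← neg_add, add_comm (letterCode y)]
      ring

theorem odd_sign {a : ℤ} (h : a ≠ 0) : Odd a.sign := by
  rcases h.lt_or_gt with h | h
  · rw [Int.sign_eq_neg_one_of_neg h]; decide
  · rw [Int.sign_eq_one_of_pos h]; decide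

theorem odd_wordWeight {l : List (α × Bool)} (h : IsReduced l) (hl : l ≠ []) :
    Odd (wordWeight l) := by
  induction l with
  | nil => exact absurd rfl hl
  | cons x l ih =>
    rcases l with _ | ⟨y, l⟩
    · exact odd_sign (letterCode_ne_zero x)
    · rw [isReduced_cons_cons] at h
      exact ((odd_sign (letterCode_ne_zero x)).add_odd
        (odd_sign (letterCode_add_ne_zero h.1))).add_odd (ih h.2 (by simp))

variable [DecidableEq α]

/-- The weight of the reduced word of an element of a free group. -/
def weight (g : FreeGroup α) : ℤ :=
  wordWeight g.toWord

@[simp]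
theorem weight_one : weight (1 : FreeGroup α) = 0 := by
  simp [weight, wordWeight]

theorem weight_inv (g : FreeGroup α) : weight g⁻¹ = -weight g := by
  rw [weight, toWord_inv, wordWeight_invRev, weight]

theorem odd_weight {g : FreeGroup α} (h : g ≠ 1) : Odd (weight g) :=
  odd_wordWeight isReduced_toWord (by simpa using h)

theorem sign_cases (a : ℤ) : a < 0 ∧ a.sign = -1 ∨ a = 0 ∧ a.sign = 0 ∨ 0 < a ∧ a.sign = 1 := by
  rcases lt_trichotomy a 0 with h | h | h
  · exact .inl ⟨h, Int.sign_eq_neg_one_of_neg h⟩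
  · exact .inr (.inl ⟨h, by simp [h]⟩)
  · exact .inr (.inr ⟨h, Int.sign_eq_one_of_pos h⟩)

theorem le_sign_add (a b : ℤ) : a.sign + b.sign ≤ (a + b).sign + 1 := by
  have := sign_cases a
  have := sign_cases b
  have := sign_cases (a + b)
  omega

theorem weight_add_le (g h : FreeGroup α) : weight g + weight h ≤ weight (g * h) + 1 := by
  obtain ⟨u, w, v, h₁, h₂, h₃⟩ := exists_toWord_mul_eq_append g h
  rw [weight, weight, weight, h₁, h₂, h₃, wordWeight_append, wordWeight_append,
    wordWeight_append, wordWeight_invRev]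
  suffices turnSign u.getLast? w.head? + turnSign (invRev w).getLast? v.head? ≤
      turnSign u.getLast? v.head? + 1 by linarith
  rw [getLast?_invRev]
  rcases u.getLast? with _ | p <;> rcases w.head? with _ | q <;> rcases v.head? with _ | r
  case some.some.some =>
    have := le_sign_add (letterCode p + letterCode q) (-letterCode q + letterCode r)
    rw [show letterCode p + letterCode q + (-letterCode q + letterCode r) =
      letterCode p + letterCode r by ring] at this
    simpa [turnSign, letterCode_inv] using this
  case none.some.some =>
    have := sign_cases (-letterCode q + letterCode r)
    simp only [turnSign, letterCode_inv, Option.map_some]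
    omega
  case some.some.none =>
    have := sign_cases (letterCode p + letterCode q)
    simp only [turnSign, Option.map_some]
    omega
  case some.none.some =>
    have := sign_cases (letterCode p + letterCode r)
    simp only [turnSign, Option.map_none]
    omega
  all_goals simp [turnSign]

end Weight

section FreeCone

open FreeGroup Multiplicative

/-- A positive cone of `FreeGroup α × ℤ`: multiplying `weight` by one half and passing to the
`ℤ`-coordinate makes up for the failure of `weight` to be additive. -/
def freeCone (α : Type*) [Encodable α] [DecidableEq α] : Set (FreeGroup α × Multiplicative ℤ) :=
  {x | 0 < weight x.1 + 2 * x.2.toAdd}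

theorem isPositiveCone_freeCone {α : Type*} [Encodable α] [DecidableEq α] :
    IsPositiveCone (freeCone α) where
  one_notMem := by simp [freeCone]
  mul_mem {a b} ha hb := by
    have := weight_add_le a.1 b.1
    simp only [freeCone, Set.mem_ofPred_eq, Prod.fst_mul, Prod.snd_mul, toAdd_mul] at *
    omega
  mem_or_eq_one_or_inv_mem := by
    rintro ⟨g, m⟩
    simp only [freeCone, Set.mem_ofPred_eq, Prod.fst_inv, Prod.snd_inv, toAdd_inv, weight_inv]
    rcases lt_trichotomy 0 (weight g + 2 * m.toAdd) with h | h | h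
    · exact .inl h
    · obtain rfl : g = 1 := by
        by_contra hg
        obtain ⟨k, hk⟩ := odd_weight hg
        omega
      rw [weight_one] at h
      exact .inr (.inl (Prod.ext rfl (toAdd.injective (by simpa using h.symm))))
    · exact .inr (.inr (by omega))

variable {α : Type}

/-- The automaton which reads a reduced word letter by letter, remembering the last letter, while
the second coordinate starts at `a`, changes by `c o y` when the letter `y` is read after the last
letter `o`, and can be increased at any time. -/
inductive EpigraphEdge (a : ℤ) (c : Option (α × Bool) → α × Bool → ℤ) :
    Option (Option (α × Bool)) → FreeGroup α × Multiplicative ℤ → Option (Option (α × Bool)) → Prop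
  | init : EpigraphEdge a c none (1, ofAdd a) (some none)
  | increase (o) : EpigraphEdge a c (some o) (1, ofAdd 1) (some o)
  | read (o y) (h : ∀ x ∈ o, x.1 = y.1 → x.2 = y.2) :
    EpigraphEdge a c (some o) (mk [y], ofAdd (c o y)) (some (some y))

/-- The group automaton with edges `EpigraphEdge`. -/
def epigraphAutomaton (a : ℤ) (c : Option (α × Bool) → α × Bool → ℤ) :
    GroupAutomaton (FreeGroup α × Multiplicative ℤ) (Option (Option (α × Bool))) where
  edge := EpigraphEdge a c
  finite_edge := by
    rintro (_ | o) (_ | _ | y)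
    case some.some.some =>
      refine (Set.toFinite {(1, ofAdd 1), (mk [y], ofAdd (c o y))}).subset ?_
      rintro _ (_ | _) <;> simp
    all_goals
      refine (Set.toFinite {(1, ofAdd a), (1, ofAdd 1)}).subset ?_
      rintro _ (_ | _) <;> simp
  start := {none}
  accept := Set.range some

theorem isReduced_append_singleton_iff {l : List (α × Bool)} {y : α × Bool} :
    FreeGroup.IsReduced (l ++ [y]) ↔
      FreeGroup.IsReduced l ∧ ∀ x ∈ l.getLast?, x.1 = y.1 → x.2 = y.2 := by
  simp [FreeGroup.IsReduced, List.isChain_append]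

variable [DecidableEq α]

theorem toWord_mul_mk_singleton {g : FreeGroup α} {y : α × Bool}
    (h : FreeGroup.IsReduced (g.toWord ++ [y])) : (g * mk [y]).toWord = g.toWord ++ [y] := by
  rw [← h.reduce_eq, ← toWord_mk, ← mul_mk, mk_toWord]

variable {L : FreeGroup α → ℤ} {c : Option (α × Bool) → α × Bool → ℤ}
  (hL : ∀ g y, FreeGroup.IsReduced (g.toWord ++ [y]) →
    L (g * mk [y]) = L g + c g.toWord.getLast? y)

include hL

theorem of_path_epigraphAutomaton {x : FreeGroup α × Multiplicative ℤ}
    {q : Option (Option (α × Bool))} (h : (epigraphAutomaton (L 1) c).Path none x q) :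
    q = none ∧ x = 1 ∨ q = some x.1.toWord.getLast? ∧ L x.1 ≤ x.2.toAdd := by
  induction h with
  | refl => exact .inl ⟨rfl, rfl⟩
  | @snoc x _ _ _ _ ha ih =>
    rcases ha with _ | o | ⟨o, y, ho⟩
    · obtain ⟨-, rfl⟩ := ih.resolve_right (by simp)
      exact .inr (by simp)
    · obtain ⟨ho, hle⟩ := ih.resolve_left (by simp)
      refine .inr ⟨by simpa using ho, ?_⟩
      simp only [Prod.fst_mul, Prod.snd_mul, mul_one, toAdd_mul, toAdd_ofAdd]
      omega
    · obtain ⟨hlast, hle⟩ := ih.resolve_left (by simp)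
      obtain rfl := Option.some_injective _ hlast
      have hred := isReduced_append_singleton_iff.2 ⟨isReduced_toWord, ho⟩
      refine .inr ⟨by simp [toWord_mul_mk_singleton hred], ?_⟩
      simpa [hL _ _ hred] using hle

theorem epigraphAutomaton_path (w : List (α × Bool)) (hw : FreeGroup.IsReduced w) :
    (epigraphAutomaton (L 1) c).Path none (mk w, ofAdd (L (mk w))) (some w.getLast?) := by
  induction w using List.reverseRecOn with
  | nil => exact .single .init
  | append_singleton w y ih =>
    obtain ⟨hw', hy⟩ := isReduced_append_singleton_iff.1 hw
    have := (ih hw').snoc (.read _ y hy)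
    have hword : (mk w).toWord = w := hw'.reduce_eq
    simpa [← mul_mk, hL (mk w) y (by rwa [hword]), hword] using this

theorem elements_epigraphAutomaton :
    (epigraphAutomaton (L 1) c).elements = {x | L x.1 ≤ x.2.toAdd} := by
  ext ⟨g, m⟩
  constructor
  · rintro ⟨_, rfl, _, ⟨o, rfl⟩, h⟩
    exact ((of_path_epigraphAutomaton hL h).resolve_left (by simp)).2
  · intro hm
    have loop (o) (k : ℕ) :
        (epigraphAutomaton (L 1) c).Path (some o) (1, ofAdd (k : ℤ)) (some o) := by
      induction k with
      | zero => exact .refl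
      | succ k ih => simpa using ih.snoc (.increase o)
    obtain ⟨k, hk⟩ := Int.le.dest hm
    refine ⟨none, rfl, some g.toWord.getLast?, ⟨_, rfl⟩, ?_⟩
    have := (epigraphAutomaton_path hL g.toWord isReduced_toWord).trans (loop _ k)
    simpa [← ofAdd_add, mk_toWord, hk] using this

omit hL

theorem isRationalSubset_freeCone [Finite α] [Encodable α] : IsRationalSubset (freeCone α) := by
  have hcone : freeCone α = {x | (2 - weight x.1) / 2 ≤ x.2.toAdd} := by
    ext x
    simp only [freeCone, Set.mem_ofPred_eq]
    omega
  let c : Option (α × Bool) → α × Bool → ℤ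
    | none, y => -(((letterCode y).sign + 1) / 2)
    | some x, y => -(((letterCode y).sign + (letterCode x + letterCode y).sign) / 2)
  rw [hcone]
  refine ⟨_, inferInstance, epigraphAutomaton ((2 - weight 1) / 2) c,
    elements_epigraphAutomaton (L := fun g => (2 - weight g) / 2) fun g y hred => ?_⟩
  have hweight : weight (g * mk [y]) =
      weight g + turnSign g.toWord.getLast? (some y) + (letterCode y).sign := by
    rw [weight, toWord_mul_mk_singleton hred, wordWeight_append]
    rfl
  have := sign_cases (letterCode y)
  have := letterCode_ne_zero y
  rw [hweight]
  rcases hlast : g.toWord.getLast? with _ | x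
  · obtain rfl : g = 1 := by simpa using hlast
    simp only [turnSign, weight_one, c]
    omega
  · have hg : g ≠ 1 := by rintro rfl; simp at hlast
    obtain ⟨k, hk⟩ := odd_weight hg
    have := sign_cases (letterCode x + letterCode y)
    have := letterCode_add_ne_zero ((isReduced_append_singleton_iff.1 hred).2 x hlast)
    simp only [turnSign, c]
    omega

/-- This is the projection of the epigraph of the constant `1` on the trivial free group. -/
theorem isRationalSubset_setOf_toAdd_pos :
    IsRationalSubset {m : Multiplicative ℤ | 0 < m.toAdd} := by
  have : IsRationalSubset {x : FreeGroup Empty × Multiplicative ℤ | 1 ≤ x.2.toAdd} :=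
    ⟨_, inferInstance, epigraphAutomaton 1 0,
      elements_epigraphAutomaton (L := fun _ => 1) fun _ y => y.1.elim⟩
  convert this.image (MonoidHom.snd _ _) using 1
  ext m
  exact ⟨fun h => ⟨(1, m), h, rfl⟩, by rintro ⟨x, hx, rfl⟩; exact hx⟩

theorem exists_isRegularLeftOrder_multiplicative_int :
    ∃ lt : Multiplicative ℤ → Multiplicative ℤ → Prop, IsRegularLeftOrder lt := by
  have hcone : IsPositiveCone {m : Multiplicative ℤ | 0 < m.toAdd} :=
    { one_notMem := by simp
      mul_mem := fun {a b} (ha : 0 < a.toAdd) (hb : 0 < b.toAdd) =>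
        show 0 < (a * b).toAdd by simpa using add_pos ha hb
      mem_or_eq_one_or_inv_mem := fun m => by
        simpa [eq_comm, ← toAdd_eq_zero] using lt_trichotomy 0 m.toAdd }
  exact ⟨_, hcone.isRegularLeftOrder isRationalSubset_setOf_toAdd_pos⟩

end FreeCone

/-! ### One-counter automata -/

/-- The integer encoded by a sign and a stack with one letter. A positive or negative sign counts
for one more than the height of the stack, so that the sign alone tells whether the integer
vanishes. -/
def counterValue (ε : SignType) (γ : List Unit) : ℤ :=
  ε * (γ.length + 1)

/-- The new sign, and the word replacing the top `t` of the stack, when `δ` is added to an integer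
of sign `ε`. -/
def counterMove (ε δ : SignType) (t : Option Unit) : SignType × List Unit :=
  if ε = 0 then (δ, [])
  else if t = none ∧ δ = -ε then (0, [])
  else (ε, List.replicate (t.toList.length + (ε * δ : ℤ)).toNat ())

theorem counterValue_counterMove {ε : SignType} {γ : List Unit} (hγ : ε = 0 → γ = [])
    (δ : SignType) :
    counterValue (counterMove ε δ γ.head?).1 ((counterMove ε δ γ.head?).2 ++ γ.tail) =
      counterValue ε γ + δ := by
  unfold counterValue counterMove
  rcases γ with _ | ⟨_, γ⟩ <;> cases ε <;> cases δ <;> (simp at hγ ⊢; try ring)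

theorem counterMove_eq_nil {ε : SignType} {γ : List Unit} (hγ : ε = 0 → γ = []) (δ : SignType) :
    (counterMove ε δ γ.head?).1 = 0 → (counterMove ε δ γ.head?).2 ++ γ.tail = [] := by
  unfold counterMove
  rcases γ with _ | ⟨_, γ⟩ <;> cases ε <;> cases δ <;> simp at hγ ⊢

theorem counterValue_eq_zero {ε : SignType} {γ : List Unit} : counterValue ε γ = 0 ↔ ε = 0 := by
  have : (γ.length + 1 : ℤ) ≠ 0 := by omega
  rw [counterValue, mul_eq_zero_iff_right this]
  cases ε <;> simp

section CounterAutomaton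

variable {X : Type u} {σ : Type} (M : DFA X σ)

/-- The sum of the weights `d s a` of the moves of a deterministic automaton reading a word, where
`s` is the state in which the letter `a` is read. -/
def weightSum (d : σ → X → SignType) : σ → List X → ℤ
  | _, [] => 0
  | s, a :: w => d s a + weightSum d (M.step s a) w

/-- The automaton with one stack letter which simulates a deterministic automaton and counts the
weights of its moves; it accepts if the simulated automaton does and the count is zero. -/
def counterAutomaton (d : σ → X → SignType) : PushdownAutomaton X Unit (σ × SignType) where
  trans p i t := {q | ∃ a ∈ i, q = ((M.step p.1 a, (counterMove p.2 (d p.1 a) t).1),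
    (counterMove p.2 (d p.1 a) t).2)}
  finite_trans p i t := by
    cases i <;> simp
  start := (M.start, 0)
  initStack := []
  accept := M.accept ×ˢ {0}

theorem counterAutomaton_step_iff {d : σ → X → SignType} {s : σ} {ε : SignType} {w : List X}
    {γ : List Unit} {c : (σ × SignType) × List X × List Unit} :
    (counterAutomaton M d).Step ((s, ε), w, γ) c ↔ ∃ a w', w = a :: w' ∧
      c = ((M.step s a, (counterMove ε (d s a) γ.head?).1), w',
        (counterMove ε (d s a) γ.head?).2 ++ γ.tail) := by
  constructor
  · rintro ⟨_, v, hw, ⟨a, rfl, h⟩, hγ⟩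
    obtain ⟨⟨s', ε'⟩, w', γ'⟩ := c
    obtain ⟨hq, rfl⟩ := Prod.mk.inj h
    exact ⟨a, w', hw, Prod.ext hq (Prod.ext rfl hγ)⟩
  · rintro ⟨a, w, rfl, rfl⟩
    exact ⟨some a, _, rfl, ⟨a, rfl, rfl⟩, rfl⟩

theorem counterAutomaton_reaches_iff {d : σ → X → SignType} {s : σ} {ε : SignType} {w : List X}
    {γ : List Unit} (hγ : ε = 0 → γ = []) :
    (∃ p ∈ (counterAutomaton M d).accept, ∃ γ',
      Relation.ReflTransGen (counterAutomaton M d).Step ((s, ε), w, γ) (p, [], γ')) ↔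
      M.evalFrom s w ∈ M.accept ∧ counterValue ε γ + weightSum M d s w = 0 := by
  induction w generalizing s ε γ with
  | nil =>
    rw [weightSum, add_zero, counterValue_eq_zero, DFA.evalFrom_nil]
    constructor
    · rintro ⟨p, hp, γ', h⟩
      rcases h.cases_head with h | ⟨c, h, -⟩
      · obtain ⟨rfl, -⟩ := Prod.mk.inj h
        exact hp
      · obtain ⟨a, w', h, -⟩ := (counterAutomaton_step_iff M).1 h
        cases h
    · exact fun h => ⟨(s, ε), h, γ, .refl⟩
  | cons a w ih =>
    have step_unique {c} : (counterAutomaton M d).Step ((s, ε), a :: w, γ) c ↔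
        c = ((M.step s a, (counterMove ε (d s a) γ.head?).1), w,
          (counterMove ε (d s a) γ.head?).2 ++ γ.tail) := by
      simp [counterAutomaton_step_iff]
    rw [DFA.evalFrom_cons, weightSum, ← add_assoc, ← counterValue_counterMove hγ,
      ← ih (counterMove_eq_nil hγ _)]
    refine exists_congr fun p => and_congr_right fun _ => exists_congr fun γ' => ?_
    simp [Relation.ReflTransGen.cases_head_iff (a := ((s, ε), a :: w, γ)), step_unique]

theorem isOneCounter_weightSum_eq_zero [Finite σ] (d : σ → X → SignType) :
    Language.IsOneCounter ({w | w ∈ M.accepts ∧ weightSum M d M.start w = 0} : Set (List X)) := by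
  refine ⟨Unit, σ × SignType, by simp, inferInstance, counterAutomaton M d, Set.ext fun w => ?_⟩
  refine (counterAutomaton_reaches_iff M fun _ => rfl).trans ?_
  simp [counterValue, DFA.mem_accepts, DFA.eval]

end CounterAutomaton

section Remainder

variable {X : Type u} {σ : Type} (M : DFA X σ) {K : ℤ} (hK : 0 < K) (c : X → ℤ)

/-- The automaton `M`, which moreover keeps the remainder modulo `K` of the sum of the integers
`c a` attached to the letters `a` read. -/
noncomputable def remainderDFA : DFA X (σ × Set.Ico 0 K) where
  step p a := (M.step p.1 a,
    ⟨(p.2 + c a) % K, Int.emod_nonneg _ hK.ne', Int.emod_lt_of_pos _ hK⟩)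
  start := (M.start, ⟨0, le_rfl, hK⟩)
  accept := {p | p.1 ∈ M.accept ∧ (p.2 : ℤ) = 0}

/-- The sign of the carry. If `|c a| ≤ K` the carry lies between `-1` and `1`, hence
equals its sign. -/
noncomputable def carry (p : σ × Set.Ico 0 K) (a : X) : SignType :=
  SignType.sign ((p.2 + c a) / K)

theorem evalFrom_remainderDFA_fst (p : σ × Set.Ico 0 K) (w : List X) :
    ((remainderDFA M hK c).evalFrom p w).1 = M.evalFrom p.1 w := by
  induction w generalizing p with
  | nil => rfl
  | cons a _ ih => exact ih _

theorem mem_accepts_remainderDFA {w : List X} :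
    w ∈ (remainderDFA M hK c).accepts ↔
      w ∈ M.accepts ∧ (((remainderDFA M hK c).eval w).2 : ℤ) = 0 := by
  have hfst := evalFrom_remainderDFA_fst M hK c (remainderDFA M hK c).start w
  change ((remainderDFA M hK c).evalFrom _ w).1 ∈ M.accept ∧ _ ↔ _
  rw [hfst]
  rfl

theorem mul_weightSum_add_remainder (hc : ∀ a, |c a| ≤ K) (p : σ × Set.Ico 0 K) (w : List X) :
    K * weightSum (remainderDFA M hK c) (carry c) p w + ((remainderDFA M hK c).evalFrom p w).2 =
      p.2 + (w.map c).sum := by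
  induction w generalizing p with
  | nil => simp [weightSum]
  | cons a w ih =>
    have hcarry : (carry c p a : ℤ) = (p.2 + c a) / K := by
      obtain ⟨h₁, h₂⟩ := abs_le.1 (hc a)
      have : -1 ≤ (p.2 + c a) / K := (Int.le_ediv_iff_mul_le hK).2 (by linarith [p.2.2.1])
      have : (p.2 + c a) / K < 2 := (Int.ediv_lt_iff_lt_mul hK).2 (by linarith [p.2.2.2])
      rw [carry]
      interval_cases (p.2 + c a) / K <;> rfl
    rw [weightSum, hcarry, DFA.evalFrom_cons, mul_add, add_assoc, ih, List.map_cons,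
      List.sum_cons, ← add_assoc, ← add_assoc]
    exact congrArg (· + _) (Int.mul_ediv_add_emod _ K)

end Remainder

theorem mul_add_eq_zero_iff_of_lt {K r : ℤ} (q : ℤ) (hr : r ∈ Set.Ico 0 K) :
    K * q + r = 0 ↔ q = 0 ∧ r = 0 := by
  refine ⟨fun h => ?_, fun ⟨hq, hr⟩ => by simp [hq, hr]⟩
  obtain rfl : q = 0 := by
    rcases lt_trichotomy q 0 with hq | hq | hq
    · nlinarith [hr.1, hr.2]
    · exact hq
    · nlinarith [hr.1, hr.2]
  simpa using h

theorem isOneCounter_of_isRegular_of_sum_eq_zero {X : Type u} [Finite X] {L : Language X}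
    (hL : L.IsRegular) (c : X → ℤ) :
    Language.IsOneCounter ({w | w ∈ L ∧ (w.map c).sum = 0} : Set (List X)) := by
  obtain ⟨σ, _, M, rfl⟩ := hL
  obtain ⟨K, hcK⟩ := (Set.finite_range fun a => |c a|).bddAbove
  have hK : 0 < max K 1 := by simp
  have hc (a) : |c a| ≤ max K 1 := le_max_of_le_left (hcK ⟨a, rfl⟩)
  have hset : ({w | w ∈ M.accepts ∧ (w.map c).sum = 0} : Set (List X)) =
      {w | w ∈ (remainderDFA M hK c).accepts ∧
        weightSum (remainderDFA M hK c) (carry c) (remainderDFA M hK c).start w = 0} := by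
    ext w
    have hsum := mul_weightSum_add_remainder M hK c hc (remainderDFA M hK c).start w
    have hzero := mul_add_eq_zero_iff_of_lt
      (weightSum (remainderDFA M hK c) (carry c) (remainderDFA M hK c).start w)
      ((remainderDFA M hK c).eval w).2.2
    rw [DFA.eval, hsum.trans (zero_add _)] at hzero
    rw [Set.mem_ofPred_eq, Set.mem_ofPred_eq, mem_accepts_remainderDFA, hzero, and_assoc,
      and_comm (a := _ = 0)]
    rfl
  exact hset ▸ isOneCounter_weightSum_eq_zero _ _

theorem IsRepresentedBy.isOneCounter_preimage_inl {G : Type u} [Group G]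
    {S : Set (G × Multiplicative ℤ)} (hS : IsRepresentedBy Language.IsRegular S) :
    IsRepresentedBy Language.IsOneCounter (MonoidHom.inl G (Multiplicative ℤ) ⁻¹' S) := by
  obtain ⟨X, _, x, hx, L, hL, rfl⟩ := hS
  have heval (w : List X) : evalWord x w =
      (evalWord (fun i => (x i).1) w, .ofAdd (w.map fun i => (x i).2.toAdd).sum) := by
    induction w with
    | nil => rfl
    | cons a w ih =>
      change x a * evalWord x w = _
      rw [ih]
      simp [evalWord, ofAdd_add, Prod.ext_iff]
  refine ⟨X, inferInstance, fun i => (x i).1, fun g => ?_, _,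
    isOneCounter_of_isRegular_of_sum_eq_zero hL fun i => (x i).2.toAdd, ?_⟩
  · obtain ⟨w, hw⟩ := hx (g, 1)
    exact ⟨w, by rw [heval] at hw; exact congrArg Prod.fst hw⟩
  · ext g
    constructor
    · rintro ⟨w, ⟨hw, hsum⟩, rfl⟩
      exact ⟨w, hw, by simp [heval, hsum]⟩
    · rintro ⟨w, hw, hg⟩
      rw [heval] at hg
      exact ⟨w, ⟨hw, congrArg Prod.snd hg⟩, congrArg Prod.fst hg⟩

/-! ### The lexicographic order -/

section Lexicographic

variable {G : Type u} {Q : Type v} [Group G] [Group Q] {f : G →* Q}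

theorem isLexLedByQuotient_coneLT {P : Set G} (hP : IsPositiveCone P) {PQ : Set Q}
    (hPQ : IsPositiveCone PQ) (hle : f ⁻¹' PQ ⊆ P) (hor : ∀ g ∈ P, g ∈ f.ker ∨ f g ∈ PQ) :
    IsLexLedByQuotient f (coneLT P) := by
  refine ⟨hP.isLeftOrder, coneLT (f.ker.subtype ⁻¹' P), coneLT PQ,
    (hP.preimage f.ker.subtype_injective).isLeftOrder, hPQ.isLeftOrder, ?_⟩
  rw [positiveCone_coneLT, positiveCone_coneLT, positiveCone_coneLT]
  refine (Set.union_subset hle ?_).antisymm' fun g hg => ?_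
  · rintro _ ⟨n, hn, rfl⟩
    exact hn
  · exact (hor g hg).elim (fun h => .inr ⟨⟨g, h⟩, hg, rfl⟩) .inl

theorem isCoarselyConnectedSubset_of_preimage_subset [Nontrivial Q] (hf : Function.Surjective f)
    (hker : f.ker.FG) {PQ : Set Q} (hPQ : IsPositiveCone PQ) (hrat : IsRationalSubset PQ)
    {P : Set G} (hle : f ⁻¹' PQ ⊆ P) (hP : ∀ p ∈ P, p ∈ f.ker ∨ f p ∈ PQ) :
    IsCoarselyConnectedSubset P := by
  obtain ⟨q, hq⟩ := hPQ.nonempty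
  obtain ⟨t, rfl⟩ := hf q
  obtain ⟨T, hT, hconn⟩ := (hrat.preimage hf hker).exists_connected_induce ⟨t, hq⟩
  refine isCoarselyConnectedSubset_of_connected_induce (hT.insert t)
    (connected_induce_mulCayley_insert hconn hle fun p hp => ?_)
  rcases hP p hp with h | h
  · simpa [f.mem_ker.1 h] using hq
  · simpa using hPQ.mul_mem h hq

theorem IsRationalSubset.lexCone {N : Type*} [Group N] [Group.FG N] {ι : N →* G}
    (hf : Function.Surjective f) (hιf : ι.range = f.ker) {PN : Set N} {PQ : Set Q}
    (hN : IsRationalSubset PN) (hQ : IsRationalSubset PQ) :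
    IsRationalSubset (lexCone ι f PN PQ) :=
  (hQ.preimage hf (hιf ▸ (Group.fg_iff_subgroup_fg _).1 inferInstance)).union (hN.image ι)

/-- The positive cone, led by `Q`, on `G × ℤ` obtained by identifying the kernel of
`G × ℤ → G → Q` with `FreeGroup α × ℤ` along `ψ : FreeGroup α →* G`. -/
def prodCone {α : Type*} [Encodable α] [DecidableEq α] (ψ : FreeGroup α →* G) (f : G →* Q)
    (PQ : Set Q) : Set (G × Multiplicative ℤ) :=
  lexCone (ψ.prodMap (.id _)) (f.comp (.fst G _)) (freeCone α) PQ

theorem range_prodMap_id {N K : Type*} [Group N] [Group K] {ψ : N →* G} (hψ : ψ.range = f.ker) :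
    (ψ.prodMap (.id K)).range = (f.comp (.fst G K)).ker := by
  ext ⟨g, k⟩
  simp [MonoidHom.range_prodMap, Subgroup.mem_prod, hψ, MonoidHom.mem_ker]

theorem isPositiveCone_prodCone {α : Type*} [Encodable α] [DecidableEq α] {ψ : FreeGroup α →* G}
    (hψ : Function.Injective ψ) (hψf : ψ.range = f.ker) {PQ : Set Q} (hPQ : IsPositiveCone PQ) :
    IsPositiveCone (prodCone ψ f PQ) :=
  isPositiveCone_freeCone.lexCone (hψ.prodMap Function.injective_id) (range_prodMap_id hψf) hPQ

theorem isRationalSubset_prodCone {α : Type} [Finite α] [Encodable α] [DecidableEq α]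
    {ψ : FreeGroup α →* G} (hf : Function.Surjective f) (hψf : ψ.range = f.ker) {PQ : Set Q}
    (hPQ : IsRationalSubset PQ) : IsRationalSubset (prodCone ψ f PQ) :=
  isRationalSubset_freeCone.lexCone (f := f.comp (.fst G (Multiplicative ℤ)))
    (hf.comp Prod.fst_surjective) (range_prodMap_id hψf) hPQ

theorem mem_ker_or_map_mem_of_mem_prodCone {α : Type*} [Encodable α] [DecidableEq α]
    {ψ : FreeGroup α →* G} (hψf : ψ.range = f.ker) {PQ : Set Q} {g : G} {m : Multiplicative ℤ}
    (h : (g, m) ∈ prodCone ψ f PQ) : g ∈ f.ker ∨ f g ∈ PQ := by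
  rcases h with h | ⟨n, -, hn⟩
  · exact .inr h
  · exact .inl (hψf ▸ ⟨n.1, congrArg Prod.fst hn⟩)

theorem exists_isLexLedByQuotient_isOneCounterLeftOrder {α : Type} [Finite α] [Nontrivial Q]
    (hf : Function.Surjective f) (e : f.ker ≃* FreeGroup α) {ltQ : Q → Q → Prop}
    (hQ : IsRegularLeftOrder ltQ) :
    ∃ lt, IsLexLedByQuotient f lt ∧ IsOneCounterLeftOrder lt ∧
      IsCoarselyConnectedSubset (positiveCone lt) ∧
      ∃ lt' : G × Multiplicative ℤ → G × Multiplicative ℤ → Prop,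
        IsRegularLeftOrder lt' ∧ ExtendsLeftFactor lt' lt := by
  classical
  have := Fintype.ofFinite α
  have := Fintype.toEncodable α
  have hPQ := hQ.1.isPositiveCone
  have hratQ := hQ.2.isRationalSubset
  let ψ : FreeGroup α →* G := f.ker.subtype.comp e.symm
  have hψ : Function.Injective ψ := f.ker.subtype_injective.comp e.symm.injective
  have hψf : ψ.range = f.ker := by
    rw [MonoidHom.range_comp, MonoidHom.range_eq_top.2 e.symm.surjective,
      ← MonoidHom.range_eq_map, f.ker.range_subtype]
  have hker : f.ker.FG := hψf ▸ (Group.fg_iff_subgroup_fg _).1 inferInstance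
  let P' := prodCone ψ f (positiveCone ltQ)
  have hP' : IsPositiveCone P' := isPositiveCone_prodCone hψ hψf hPQ
  have hreg := hP'.isRegularLeftOrder (isRationalSubset_prodCone hf hψf hratQ)
  let P : Set G := MonoidHom.inl G (Multiplicative ℤ) ⁻¹' P'
  have hP : IsPositiveCone P := hP'.preimage fun _ _ h => congrArg Prod.fst h
  have hle : f ⁻¹' positiveCone ltQ ⊆ P := fun _ => .inl
  have hor (g) (hg : g ∈ P) := mem_ker_or_map_mem_of_mem_prodCone hψf hg
  refine ⟨coneLT P, isLexLedByQuotient_coneLT hP hPQ hle hor, ⟨hP.isLeftOrder, ?_⟩, ?_, coneLT P',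
    hreg, fun a b => ?_⟩
  · simpa only [positiveCone_coneLT] using hreg.2.isOneCounter_preimage_inl
  · rw [positiveCone_coneLT]
    exact isCoarselyConnectedSubset_of_preimage_subset hf hker hPQ hratQ hle hor
  · simp [coneLT, P]

end Lexicographic

theorem mainTheorem5_general {G : Type u} {Q : Type v} [Group G] [Group Q] (f : G →* Q)
    (hf : Function.Surjective f) {α : Type*} (hker : Nonempty (f.ker ≃* FreeGroup α)) :
    (Nontrivial α → ∀ lt : G → G → Prop, IsLexLedByQuotient f lt → ¬ IsRegularLeftOrder lt) ∧
    (Finite α → Nontrivial Q → (∃ ltQ : Q → Q → Prop, IsRegularLeftOrder ltQ) →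
      ∃ lt : G → G → Prop, IsLexLedByQuotient f lt ∧ IsOneCounterLeftOrder lt ∧
        IsCoarselyConnectedSubset (positiveCone lt) ∧
        ∃ lt' : G × Multiplicative ℤ → G × Multiplicative ℤ → Prop,
          IsRegularLeftOrder lt' ∧ ExtendsLeftFactor lt' lt) := by
  obtain ⟨e⟩ := hker
  refine ⟨fun _ lt h => h.not_isRegularLeftOrder e, ?_⟩
  rintro _ _ ⟨ltQ, hQ⟩
  exact exists_isLexLedByQuotient_isOneCounterLeftOrder hf
    (e.trans (FreeGroup.freeGroupCongr (Finite.equivFin α))) hQ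

theorem mainTheorem5 {G : Type u} [Group G] (f : G →* Multiplicative ℤ)
    (hf : Function.Surjective f) (n : ℕ) (hn : 2 ≤ n)
    (hker : Nonempty (f.ker ≃* FreeGroup (Fin n))) :
    (∀ lt : G → G → Prop, IsLexLedByQuotient f lt → ¬ IsRegularLeftOrder lt) ∧
    (∃ lt : G → G → Prop, IsLexLedByQuotient f lt ∧ IsOneCounterLeftOrder lt ∧
      IsCoarselyConnectedSubset (positiveCone lt) ∧
      ∃ lt' : G × Multiplicative ℤ → G × Multiplicative ℤ → Prop,
        IsRegularLeftOrder lt' ∧ ExtendsLeftFactor lt' lt) :=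
  (mainTheorem5_general f hf hker).imp (· (Fin.nontrivial_iff_two_le.2 hn))
    (· inferInstance inferInstance exists_isRegularLeftOrder_multiplicative_int)
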